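/- Let $\alpha_0,\dots,\alpha_5\in\mathbb{C}$ satisfy $2\alpha_0+2\alpha_1+2\alpha_2+2\alpha_3+\alpha_4+\alpha_5=1$, and let $H\in\mathbb{C}(t)[x,y,z,w,q,p]$ be the Hamiltonian of the system $$\frac{dx}{dt}=\frac{\partial H}{\partial y},\quad \frac{dy}{dt}=-\frac{\partial H}{\partial x},\quad \frac{dz}{dt}=\frac{\partial H}{\partial w},\quad \frac{dw}{dt}=-\frac{\partial H}{\partial z},\quad \frac{dq}{dt}=\frac{\partial H}{\partial p},\quad \frac{dp}{dt}=-\frac{\partial H}{\partial q}.\qquad(*)$$ Assume the following. (B1) $H$ has total degree $4$ in $x,y,z,w,q,p$. (B2) The system becomes again a polynomial Hamiltonian system in each of the coordinate systems $r_i$, $i=0,1,2,4,5$, given by $$\begin{aligned} r_0&:\ x_0=x+\tfrac{2\alpha_0}{y}+\tfrac1{y^2},\ y_0=y,\ z_0=z,\ w_0=w,\ q_0=q,\ p_0=p,\\ r_1&:\ x_1=-((x-z)y-\alpha_1)y,\ y_1=1/y,\ z_1=z,\ w_1=w+y,\ q_1=q,\ p_1=p,\\ r_2&:\ x_2=x,\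 y_2=y,\ z_2=1/z,\ w_2=-(wz+\alpha_2)z,\ q_2=q,\ p_2=p,\\ r_4&:\ x_4=x,\ y_4=y,\ z_4=z,\ w_4=w,\ q_4=1/q,\ p_4=-(pq+\alpha_4)q,\\ r_5&:\ x_5=x,\ y_5=y,\ z_5=z,\ w_5=w,\ q_5=1/q,\ p_5=-((p-t)q+\alpha_5)q. \end{aligned}$$ This means that $H$, for $i=0,1,2,4$, and $H+q$, for $i=5$, is a polynomial with coefficients in $\mathbb{C}(t)$ in the six functions $x_i,y_i,z_i,w_i,q_i,p_i$. (B3) The system written in the coordinates $r_4$ becomes again a polynomial Hamiltonian system in the coordinate system $$r_3:\ x_3=x_4,\ y_3=y_4,\ z_3=-((z_4-q_4)w_4-\alpha_3)w_4,\ w_3=1/w_4,\ q_3=q_4,\ p_3=p_4+w_4.$$ This means that $H$ is a polynomial with coefficients in $\mathbb{C}(t)$ in $x_3,y_3,z_3,w_3,q_3,p_3$. Then the system $(*)$ coincides with $$\begin{aligned} \tfrac{dx}{dt}&=\tfrac1t\bigl(2x^2y+2z^2w+2\alpha_0x+2\alpha_2z-2p+t\bigr),\\ \tfrac{dy}{dt}&=\tfrac1t\bigl(-2xy^2-2\alpha_0y-1\bigr),\\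 \tfrac{dz}{dt}&=\tfrac1t\bigl(2z^2w+2yz^2+2(\alpha_0+\alpha_1+\alpha_2)z-2p+t\bigr),\\ \tfrac{dw}{dt}&=\tfrac1t\bigl(-2zw^2-4yzw-2\alpha_2y-2(\alpha_0+\alpha_1+\alpha_2)w\bigr),\\ \tfrac{dq}{dt}&=\tfrac1t\bigl(2q^2p-tq^2-2y-2w-2(\alpha_0+\alpha_1+\alpha_2+\alpha_3)q\bigr),\\ \tfrac{dp}{dt}&=\tfrac1t\bigl(-2qp^2+2tqp+2(\alpha_0+\alpha_1+\alpha_2+\alpha_3)p+t\alpha_4\bigr), \end{aligned}$$ and, up to an additive term in $\mathbb{C}(t)$ (which does not affect the system), $H$ equals $$\tfrac1t\Bigl(x^2y^2+2\alpha_0xy+x+ty+z^2w^2+2(\alpha_0+\alpha_1+\alpha_2)zw+tw+q^2p^2-tq^2p+(\alpha_4+\alpha_5-1)qp-\alpha_4tq+2yz(zw+\alpha_2)-2(y+w)p\Bigr).$$ -/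

import Mathlib

/-!  Hamiltonian systems in the six variables `x, y, z, w, q, p` over the field `ℂ(t)`.
Throughout, the index set is `Fin 6` with `0, 1, 2, 3, 4, 5` standing for `x, y, z, w, q, p`, so that
the canonically conjugate pairs are `(0, 1)`, `(2, 3)` and `(4, 5)`. -/

namespace B5

noncomputable section

/-- The coefficient field `ℂ(t)`. -/
abbrev Coef : Type := RatFunc ℂ

/-- The polynomial ring `ℂ(t)[x, y, z, w, q, p]`. -/
abbrev Poly : Type := MvPolynomial (Fin 6) Coef

/-- The field of rational functions `ℂ(t)(x, y, z, w, q, p)`. -/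
abbrev RatField : Type := FractionRing Poly

/-- The independent variable `t`, as an element of `ℂ(t)`. -/
def t : Coef := RatFunc.X

/-- The complex number `c`, as an element of `ℂ(t)(x, y, z, w, q, p)`. -/
def cst (c : ℂ) : RatField := algebraMap Coef RatField (RatFunc.C c)

/-- The independent variable `t`, as an element of `ℂ(t)(x, y, z, w, q, p)`. -/
def tt : RatField := algebraMap Coef RatField t

/-- The original coordinates `x, y, z, w, q, p`, as elements of `ℂ(t)(x, y, z, w, q, p)`. -/
def coord (i : Fin 6) : RatField := algebraMap Poly RatField (MvPolynomial.X i)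

/-! The coordinate changes. Each takes six coordinates `u = (x, y, z, w, q, p)` and returns the six
new coordinates, as rational functions of `u`. -/

/-- The coordinate system `r₀`. -/
def r0 (α : Fin 6 → ℂ) (u : Fin 6 → RatField) : Fin 6 → RatField :=
  ![u 0 + 2 * cst (α 0) / u 1 + 1 / u 1 ^ 2, u 1, u 2, u 3, u 4, u 5]

/-- The coordinate system `r₁`. -/
def r1 (α : Fin 6 → ℂ) (u : Fin 6 → RatField) : Fin 6 → RatField :=
  ![-((u 0 - u 2) * u 1 - cst (α 1)) * u 1, 1 / u 1, u 2, u 3 + u 1, u 4, u 5]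

/-- The coordinate system `r₂`. -/
def r2 (α : Fin 6 → ℂ) (u : Fin 6 → RatField) : Fin 6 → RatField :=
  ![u 0, u 1, 1 / u 2, -(u 3 * u 2 + cst (α 2)) * u 2, u 4, u 5]

/-- The coordinate change `r₃`, to be applied to the coordinates of `r₄`. -/
def r3 (α : Fin 6 → ℂ) (u : Fin 6 → RatField) : Fin 6 → RatField :=
  ![u 0, u 1, -((u 2 - u 4) * u 3 - cst (α 3)) * u 3, 1 / u 3, u 4, u 5 + u 3]

/-- The coordinate system `r₄`. -/
def r4 (α : Fin 6 → ℂ) (u : Fin 6 → RatField) : Fin 6 → RatField :=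
  ![u 0, u 1, u 2, u 3, 1 / u 4, -(u 5 * u 4 + cst (α 4)) * u 4]

/-- The coordinate system `r₅` (the only one that depends on `t`). -/
def r5 (α : Fin 6 → ℂ) (u : Fin 6 → RatField) : Fin 6 → RatField :=
  ![u 0, u 1, u 2, u 3, 1 / u 4, -((u 5 - tt) * u 4 + cst (α 5)) * u 4]

/-- The rational function `F` is a polynomial over `ℂ(t)` in the six coordinates `r`. -/
def IsPolynomialIn (r : Fin 6 → RatField) (F : RatField) : Prop :=
  ∃ K : Poly, MvPolynomial.aeval r K = F

/-- The right-hand side of the Hamiltonian system with Hamiltonian `H`: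
`x' = ∂H/∂y, y' = -∂H/∂x, z' = ∂H/∂w, w' = -∂H/∂z, q' = ∂H/∂p, p' = -∂H/∂q`. -/
def hamiltonianField (H : Poly) : Fin 6 → Poly :=
  ![MvPolynomial.pderiv 1 H, -MvPolynomial.pderiv 0 H,
    MvPolynomial.pderiv 3 H, -MvPolynomial.pderiv 2 H,
    MvPolynomial.pderiv 5 H, -MvPolynomial.pderiv 4 H]

/-- The complex number `c`, as a constant polynomial. -/
def pc (c : ℂ) : Poly := MvPolynomial.C (RatFunc.C c)

/-- The polynomial Hamiltonian of the system of type `B₅⁽¹⁾`. -/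
def hamiltonianB5 (α : Fin 6 → ℂ) : Poly :=
  let x : Poly := MvPolynomial.X 0
  let y : Poly := MvPolynomial.X 1
  let z : Poly := MvPolynomial.X 2
  let w : Poly := MvPolynomial.X 3
  let q : Poly := MvPolynomial.X 4
  let p : Poly := MvPolynomial.X 5
  let T : Poly := MvPolynomial.C t
  MvPolynomial.C t⁻¹ *
    ((x ^ 2 * y ^ 2 + 2 * pc (α 0) * x * y + x + T * y)
      + (z ^ 2 * w ^ 2 + 2 * pc (α 0 + α 1 + α 2) * z * w + T * w)
      + (q ^ 2 * p ^ 2 - T * q ^ 2 * p + pc (α 4 + α 5 - 1) * q * p - pc (α 4) * T * q)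
      + 2 * y * z * (z * w + pc (α 2))
      - 2 * (y + w) * p)

/-- The right-hand side of the system of type `B₅⁽¹⁾`, written out. -/
def fieldB5 (α : Fin 6 → ℂ) : Fin 6 → Poly :=
  let x : Poly := MvPolynomial.X 0
  let y : Poly := MvPolynomial.X 1
  let z : Poly := MvPolynomial.X 2
  let w : Poly := MvPolynomial.X 3
  let q : Poly := MvPolynomial.X 4
  let p : Poly := MvPolynomial.X 5
  let T : Poly := MvPolynomial.C t
  let c : Poly := MvPolynomial.C t⁻¹
  ![c * (2 * x ^ 2 * y + 2 * z ^ 2 * w + 2 * pc (α 0) * x + 2 * pc (α 2) * z - 2 * p + T),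
    c * (-2 * x * y ^ 2 - 2 * pc (α 0) * y - 1),
    c * (2 * z ^ 2 * w + 2 * y * z ^ 2 + 2 * pc (α 0 + α 1 + α 2) * z - 2 * p + T),
    c * (-2 * z * w ^ 2 - 4 * y * z * w - 2 * pc (α 2) * y - 2 * pc (α 0 + α 1 + α 2) * w),
    c * (2 * q ^ 2 * p - T * q ^ 2 - 2 * y - 2 * w - 2 * pc (α 0 + α 1 + α 2 + α 3) * q),
    c * (-2 * q * p ^ 2 + 2 * T * q * p + 2 * pc (α 0 + α 1 + α 2 + α 3) * p + T * pc (α 4))]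

end

end B5

/-! Each chart can be solved for the original coordinates. Keeping five new coordinates constant and
letting the remaining one be a parameter `s` gives a curve, defined for `s ≠ 0`, that crosses the
polar divisor at `s = 0`. A function that is polynomial in the chart is polynomial in `s` along this
curve (`IsPolynomialIn.isRegular`), so all its polar coefficients vanish. The degree bound leaves
finitely many monomials in `H`, and the vanishing of polar coefficients is a system of linear
equations for their coefficients. The parameter `t` is a mere scalar: points have coordinates in the
infinite field `ℂ(t)`.

The charts `r₀`, `r₂`, `r₄`, `r₅` each change a single conjugate pair, so their equations hold
separately for each monomial in the other pairs. The chart `r₁` couples `(x, y)` with `(z, w)`.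
Together `r₀`, `r₁`, `r₂` force every coefficient of `q ^ i * p ^ j` to be a combination of powers
of `y + w`, of `x * y ^ 2 - α₁ * y + z * w * (2 * y + w)`, possibly times `y + w`, and of one
quartic (`sum_sum_eq_normalForm`).

The charts `r₄` and `r₅` then treat the pair `(q, p)`. Since `r₅` concerns `H + q` instead of `H`,
its equations are inhomogeneous; they produce the term `-q * p / t`, which fixes the scale of `H`.

Finally `r₃` couples `(z, w)` with `(q, p)` (`IsRegular.r3_relations`). Its polar coefficients are
polynomials in `q`. Reading them from the deepest pole upwards leaves, besides the additive
constant, four nonzero unknowns, and the relation between the `αᵢ` turns the last equation into `h =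
1 / t`. -/

namespace B5

/-! ### Values of rational functions at points -/

/-- The rational function `f` is defined at the point `a` and takes the value `c` there. -/
def HasValueAt (a : Fin 6 → Coef) (f : RatField) (c : Coef) : Prop :=
  ∃ P Q : Poly, MvPolynomial.eval a Q ≠ 0 ∧
    f * algebraMap Poly RatField Q = algebraMap Poly RatField P ∧
    MvPolynomial.eval a P = c * MvPolynomial.eval a Q

namespace HasValueAt

variable {a : Fin 6 → Coef} {f g : RatField} {c d : Coef}

theorem of_poly (a : Fin 6 → Coef) (P : Poly) :
    HasValueAt a (algebraMap Poly RatField P) (MvPolynomial.eval a P) :=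
  ⟨P, 1, by simp, by simp, by simp⟩

theorem of_coef (a : Fin 6 → Coef) (c : Coef) : HasValueAt a (algebraMap Coef RatField c) c := by
  have h := of_poly a (MvPolynomial.C c)
  rwa [MvPolynomial.eval_C, ← MvPolynomial.algebraMap_eq,
    ← IsScalarTower.algebraMap_apply] at h

theorem one (a : Fin 6 → Coef) : HasValueAt a 1 1 := by simpa using of_poly a 1

theorem two (a : Fin 6 → Coef) : HasValueAt a 2 2 := by
  have h := of_poly a 2
  rwa [map_ofNat, map_ofNat] at h

theorem of_eq (h : HasValueAt a f c) (e : c = d) : HasValueAt a f d := e ▸ h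

theorem add (hf : HasValueAt a f c) (hg : HasValueAt a g d) : HasValueAt a (f + g) (c + d) := by
  obtain ⟨P, Q, hQ, h, e⟩ := hf
  obtain ⟨P', Q', hQ', h', e'⟩ := hg
  refine ⟨P * Q' + P' * Q, Q * Q', by simp [hQ, hQ'], ?_, ?_⟩
  · simp only [map_mul, map_add, ← h, ← h']; ring
  · simp only [map_mul, map_add, e, e']; ring

theorem mul (hf : HasValueAt a f c) (hg : HasValueAt a g d) : HasValueAt a (f * g) (c * d) := by
  obtain ⟨P, Q, hQ, h, e⟩ := hf
  obtain ⟨P', Q', hQ', h', e'⟩ := hg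
  refine ⟨P * P', Q * Q', by simp [hQ, hQ'], ?_, ?_⟩
  · simp only [map_mul, ← h, ← h']; ring
  · simp only [map_mul, e, e']; ring

theorem neg (hf : HasValueAt a f c) : HasValueAt a (-f) (-c) := by
  obtain ⟨P, Q, hQ, h, e⟩ := hf
  exact ⟨-P, Q, hQ, by simp only [map_neg, ← h]; ring, by simp only [map_neg, e]; ring⟩

theorem sub (hf : HasValueAt a f c) (hg : HasValueAt a g d) : HasValueAt a (f - g) (c - d) := by
  simpa only [sub_eq_add_neg] using hf.add hg.neg

theorem inv (hf : HasValueAt a f c) (hc : c ≠ 0) : HasValueAt a f⁻¹ c⁻¹ := by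
  obtain ⟨P, Q, hQ, h, e⟩ := hf
  have hP : MvPolynomial.eval a P ≠ 0 := by rw [e]; exact mul_ne_zero hc hQ
  have hf0 : f ≠ 0 := by
    rintro rfl
    rw [zero_mul, eq_comm, IsFractionRing.to_map_eq_zero_iff] at h
    simp [h] at hP
  exact ⟨Q, P, hP, by rw [← h]; field_simp, by rw [e]; field_simp⟩

theorem div (hf : HasValueAt a f c) (hg : HasValueAt a g d) (hd : d ≠ 0) :
    HasValueAt a (f / g) (c / d) := by
  simpa only [div_eq_mul_inv] using hf.mul (hg.inv hd)

theorem pow (hf : HasValueAt a f c) (n : ℕ) : HasValueAt a (f ^ n) (c ^ n) := by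
  induction n with
  | zero => simpa using of_poly a 1
  | succ n ih => simpa only [pow_succ] using ih.mul hf

/-- Cross-multiplying two fractions for `f` gives an identity of polynomials, which can be evaluated
at `a`, where both denominators are nonzero. -/
theorem unique (hf : HasValueAt a f c) (hg : HasValueAt a f d) : c = d := by
  obtain ⟨P, Q, hQ, h, e⟩ := hf
  obtain ⟨P', Q', hQ', h', e'⟩ := hg
  have key : P * Q' = P' * Q := by
    apply IsFractionRing.injective Poly RatField
    simp only [map_mul, ← h, ← h']; ring
  have := congrArg (MvPolynomial.eval a) key
  simp only [map_mul, e, e'] at this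
  have h2 : (c - d) * (MvPolynomial.eval a Q * MvPolynomial.eval a Q') = 0 := by
    linear_combination this
  rcases mul_eq_zero.1 h2 with h3 | h3
  · exact sub_eq_zero.1 h3
  · exact absurd h3 (mul_ne_zero hQ hQ')

theorem aeval {r : Fin 6 → RatField} {b : Fin 6 → Coef} (h : ∀ i, HasValueAt a (r i) (b i))
    (K : Poly) : HasValueAt a (MvPolynomial.aeval r K) (MvPolynomial.eval b K) := by
  induction K using MvPolynomial.induction_on with
  | C c => simpa using of_coef a c
  | add p q hp hq => simpa only [map_add] using hp.add hq
  | mul_X p i hp => simpa only [map_mul, MvPolynomial.aeval_X, MvPolynomial.eval_X] using hp.mul (h i)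

theorem of_coord (a : Fin 6 → Coef) (i : Fin 6) : HasValueAt a (coord i) (a i) := by
  have h := of_poly a (MvPolynomial.X i)
  rwa [MvPolynomial.eval_X] at h

end HasValueAt

/-! ### Functions of one variable that are polynomial away from the origin -/

section Regular

variable {F : Type*} [Field F]

/-- The function `f` agrees with a polynomial away from `0`. -/
@[fun_prop]
def IsRegular (f : F → F) : Prop := ∃ Q : Polynomial F, ∀ s, s ≠ 0 → f s = Q.eval s

namespace IsRegular

variable {f g : F → F}

theorem congr (hf : IsRegular f) (h : ∀ s, s ≠ 0 → f s = g s) : IsRegular g := by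
  obtain ⟨P, hP⟩ := hf
  exact ⟨P, fun s hs => by rw [← h s hs, hP s hs]⟩

@[fun_prop]
theorem const (c : F) : IsRegular fun _ : F => c := ⟨Polynomial.C c, by simp⟩

@[fun_prop]
theorem id : IsRegular fun s : F => s := ⟨Polynomial.X, by simp⟩

@[fun_prop]
theorem add (hf : IsRegular f) (hg : IsRegular g) : IsRegular fun s => f s + g s := by
  obtain ⟨P, hP⟩ := hf
  obtain ⟨Q, hQ⟩ := hg
  exact ⟨P + Q, fun s hs => by simp only [hP s hs, hQ s hs, Polynomial.eval_add]⟩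

@[fun_prop]
theorem mul (hf : IsRegular f) (hg : IsRegular g) : IsRegular fun s => f s * g s := by
  obtain ⟨P, hP⟩ := hf
  obtain ⟨Q, hQ⟩ := hg
  exact ⟨P * Q, fun s hs => by simp only [hP s hs, hQ s hs, Polynomial.eval_mul]⟩

@[fun_prop]
theorem neg (hf : IsRegular f) : IsRegular fun s => -f s := by
  simpa using (const (-1)).mul hf

@[fun_prop]
theorem sub (hf : IsRegular f) (hg : IsRegular g) : IsRegular fun s => f s - g s := by
  simpa only [sub_eq_add_neg] using hf.add hg.neg

@[fun_prop]
theorem pow (hf : IsRegular f) (n : ℕ) : IsRegular fun s => f s ^ n := by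
  obtain ⟨P, hP⟩ := hf
  exact ⟨P ^ n, fun s hs => by simp only [hP s hs, Polynomial.eval_pow]⟩

theorem sum {ι : Type*} (S : Finset ι) (f : ι → F → F) (hf : ∀ i ∈ S, IsRegular (f i)) :
    IsRegular fun s => ∑ i ∈ S, f i s := by
  classical
  induction S using Finset.induction_on with
  | empty => simpa using const (0 : F)
  | insert a S ha ih =>
    simp only [Finset.sum_insert ha]
    exact (hf a (by simp)).add (ih fun i hi => hf i (by simp [hi]))

/-- A regular function has no poles. -/
theorem principal_part_eq_zero [Infinite F] {n : ℕ} {c : ℕ → F}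
    (h : IsRegular fun s => ∑ i ∈ Finset.range n, c i / s ^ (i + 1)) : ∀ i < n, c i = 0 := by
  obtain ⟨Q, hQ⟩ := h
  -- The polar part multiplied by `s ^ n`: it has degree below `n`, yet it will be divisible by `X ^
  -- n`.
  let P : Polynomial F := ∑ i ∈ Finset.range n, Polynomial.C (c i) * Polynomial.X ^ (n - (i + 1))
  have key : P = Polynomial.X ^ n * Q := by
    refine Polynomial.eq_of_infinite_eval_eq _ _ (Set.Infinite.mono (s := {0}ᶜ) ?_
      (Set.Finite.infinite_compl (Set.finite_singleton _)))
    intro s hs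
    have hs : s ≠ 0 := by simpa using hs
    simp only [Set.mem_ofPred_eq, P, Polynomial.eval_finsetSum, Polynomial.eval_mul,
      Polynomial.eval_C, Polynomial.eval_pow, Polynomial.eval_X, ← hQ s hs, Finset.mul_sum]
    refine Finset.sum_congr rfl fun i hi => ?_
    rw [pow_sub₀ _ hs (Finset.mem_range.1 hi)]
    field_simp
  intro i hi
  have := congrArg (fun R => Polynomial.coeff R (n - (i + 1))) key
  simp only [P, Polynomial.finsetSum_coeff, Polynomial.coeff_C_mul, Polynomial.coeff_X_pow,
    Polynomial.coeff_X_pow_mul'] at this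
  rw [if_neg (by omega), Finset.sum_eq_single i] at this
  · simpa using this
  · intro j hj hji
    have := Finset.mem_range.1 hj
    rw [if_neg (by omega), mul_zero]
  · intro h
    exact absurd (Finset.mem_range.2 hi) h

/-- The coefficients of a regular family of polynomials are regular. -/
theorem coeff [Infinite F] {n : ℕ} {g : ℕ → F → F}
    (h : ∀ v, IsRegular fun s => ∑ k ∈ Finset.range n, g k s * v ^ k) :
    ∀ k < n, IsRegular (g k) := by
  -- Sampling `v` at `n` distinct points and inverting the Vandermonde matrix writes each `g k` as a
  -- constant combination of regular functions.
  let e : Fin n → F := fun i => Infinite.natEmbedding F i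
  have he : Function.Injective e := fun i j hij => Fin.ext ((Infinite.natEmbedding F).injective hij)
  have hdet : IsUnit (Matrix.vandermonde e).det :=
    isUnit_iff_ne_zero.2 (Matrix.det_vandermonde_ne_zero_iff.2 he)
  intro k hk
  have h2 : IsRegular fun s => ∑ i : Fin n, (Matrix.vandermonde e)⁻¹ ⟨k, hk⟩ i *
      ∑ j ∈ Finset.range n, g j s * e i ^ j :=
    sum _ _ fun i _ => (const _).mul (h (e i))
  refine h2.congr fun s _ => ?_
  have h3 := congrArg (fun M => (M.mulVec fun j : Fin n => g j s) ⟨k, hk⟩)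
    (Matrix.nonsing_inv_mul _ hdet)
  simp only [Matrix.one_mulVec, ← Matrix.mulVec_mulVec] at h3
  rw [← h3, Matrix.mulVec, dotProduct]
  refine Finset.sum_congr rfl fun i _ => ?_
  rw [Finset.sum_range]
  simp only [Matrix.mulVec, dotProduct, Matrix.vandermonde_apply]
  congr 1
  exact Finset.sum_congr rfl fun j _ => mul_comm _ _

end IsRegular

end Regular

/-- Along a curve which is polynomial in the chart `r`, a function that is polynomial in `r` is
regular. -/
theorem IsPolynomialIn.isRegular {r : Fin 6 → RatField} {G : Poly}
    (h : IsPolynomialIn r (algebraMap Poly RatField G)) (a : Coef → Fin 6 → Coef)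
    (b : Fin 6 → Polynomial Coef)
    (hab : ∀ s, s ≠ 0 → ∀ i, HasValueAt (a s) (r i) ((b i).eval s)) :
    IsRegular fun s => MvPolynomial.eval (a s) G := by
  obtain ⟨K, hK⟩ := h
  refine ⟨MvPolynomial.aeval b K, fun s hs => ?_⟩
  have h1 := HasValueAt.aeval (hab s hs) K
  rw [hK] at h1
  refine ((HasValueAt.of_poly _ _).unique h1).trans ?_
  clear hK h1
  induction K using MvPolynomial.induction_on with
  | C c => simp [Polynomial.algebraMap_eq]
  | add p q hp hq => simp only [map_add, Polynomial.eval_add, hp, hq]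
  | mul_X p i hp =>
    simp only [map_mul, MvPolynomial.aeval_X, MvPolynomial.eval_X, Polynomial.eval_mul, hp]

/-! ### Curves crossing the polar divisors of the charts -/

section Curves

variable {α : Fin 6 → ℂ} {G : Poly}

-- The curve is `r₀` solved for the old coordinates, with `y₀ = s` and the other new coordinates
-- constant. The curves for the other charts arise in the same way.
open HasValueAt RatFunc in
theorem isRegular_r0 (h : IsPolynomialIn (r0 α coord) (algebraMap Poly RatField G))
    (x z w q p : Coef) :
    IsRegular fun s => MvPolynomial.eval
      ![x - 2 * C (α 0) / s - 1 / s ^ 2, s, z, w, q, p] G := by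
  refine h.isRegular _ ![.C x, .X, .C z, .C w, .C q, .C p] fun s hs => ?_
  set a : Fin 6 → Coef :=
    ![x - 2 * C (α 0) / s - 1 / s ^ 2, s, z, w, q, p]
  have h0 : HasValueAt a (coord 0) (x - 2 * C (α 0) / s - 1 / s ^ 2) := of_coord a 0
  have h1 : HasValueAt a (coord 1) (s) := of_coord a 1
  have h2 : HasValueAt a (coord 2) (z) := of_coord a 2
  have h3 : HasValueAt a (coord 3) (w) := of_coord a 3
  have h4 : HasValueAt a (coord 4) (q) := of_coord a 4
  have h5 : HasValueAt a (coord 5) (p) := of_coord a 5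
  intro i
  match i with
  | 0 =>
    change HasValueAt a _ (Polynomial.eval s (Polynomial.C x))
    refine ((h0.add (((HasValueAt.two a).mul (of_coef a (C (α 0)))).div h1 hs)).add
      ((HasValueAt.one a).div (h1.pow 2) (pow_ne_zero 2 hs))).of_eq ?_
    rw [Polynomial.eval_C]
    field_simp
    try ring
  | 1 => exact h1.of_eq (by simp)
  | 2 => exact h2.of_eq (by simp)
  | 3 => exact h3.of_eq (by simp)
  | 4 => exact h4.of_eq (by simp)
  | 5 => exact h5.of_eq (by simp)

-- Here `y₁ = s`; the pole of `y` is compensated in `w`, so that `w₁ = w + y` stays constant.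
open HasValueAt RatFunc in
theorem isRegular_r1 (h : IsPolynomialIn (r1 α coord) (algebraMap Poly RatField G))
    (x z w q p : Coef) :
    IsRegular fun s => MvPolynomial.eval
      ![z + C (α 1) * s - x * s ^ 2, 1 / s, z, w - 1 / s, q, p] G := by
  refine h.isRegular _ ![.C x, .X, .C z, .C w, .C q, .C p] fun s hs => ?_
  set a : Fin 6 → Coef :=
    ![z + C (α 1) * s - x * s ^ 2, 1 / s, z, w - 1 / s, q, p]
  have h0 : HasValueAt a (coord 0) (z + C (α 1) * s - x * s ^ 2) := of_coord a 0
  have h1 : HasValueAt a (coord 1) (1 / s) := of_coord a 1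
  have h2 : HasValueAt a (coord 2) (z) := of_coord a 2
  have h3 : HasValueAt a (coord 3) (w - 1 / s) := of_coord a 3
  have h4 : HasValueAt a (coord 4) (q) := of_coord a 4
  have h5 : HasValueAt a (coord 5) (p) := of_coord a 5
  intro i
  match i with
  | 0 =>
    change HasValueAt a _ (Polynomial.eval s (Polynomial.C x))
    refine (((((h0.sub h2).mul h1).sub (of_coef a (C (α 1)))).neg).mul h1).of_eq ?_
    rw [Polynomial.eval_C]
    field_simp
    try ring
  | 1 =>
    change HasValueAt a _ (Polynomial.eval s Polynomial.X)
    refine ((HasValueAt.one a).div h1 (one_div_ne_zero hs)).of_eq ?_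
    rw [Polynomial.eval_X]
    field_simp
    try ring
  | 2 => exact h2.of_eq (by simp)
  | 3 =>
    change HasValueAt a _ (Polynomial.eval s (Polynomial.C w))
    refine (h3.add h1).of_eq ?_
    rw [Polynomial.eval_C]
    field_simp
    try ring
  | 4 => exact h4.of_eq (by simp)
  | 5 => exact h5.of_eq (by simp)

open HasValueAt RatFunc in
theorem isRegular_r2 (h : IsPolynomialIn (r2 α coord) (algebraMap Poly RatField G))
    (x y w q p : Coef) :
    IsRegular fun s => MvPolynomial.eval
      ![x, y, 1 / s, -s * (s * w + C (α 2)), q, p] G := by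
  refine h.isRegular _ ![.C x, .C y, .X, .C w, .C q, .C p] fun s hs => ?_
  set a : Fin 6 → Coef :=
    ![x, y, 1 / s, -s * (s * w + C (α 2)), q, p]
  have h0 : HasValueAt a (coord 0) (x) := of_coord a 0
  have h1 : HasValueAt a (coord 1) (y) := of_coord a 1
  have h2 : HasValueAt a (coord 2) (1 / s) := of_coord a 2
  have h3 : HasValueAt a (coord 3) (-s * (s * w + C (α 2))) := of_coord a 3
  have h4 : HasValueAt a (coord 4) (q) := of_coord a 4
  have h5 : HasValueAt a (coord 5) (p) := of_coord a 5
  intro i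
  match i with
  | 0 => exact h0.of_eq (by simp)
  | 1 => exact h1.of_eq (by simp)
  | 2 =>
    change HasValueAt a _ (Polynomial.eval s Polynomial.X)
    refine ((HasValueAt.one a).div h2 (one_div_ne_zero hs)).of_eq ?_
    rw [Polynomial.eval_X]
    field_simp
    try ring
  | 3 =>
    change HasValueAt a _ (Polynomial.eval s (Polynomial.C w))
    refine ((((h3.mul h2).add (of_coef a (C (α 2)))).neg).mul h2).of_eq ?_
    rw [Polynomial.eval_C]
    field_simp
    try ring
  | 4 => exact h4.of_eq (by simp)
  | 5 => exact h5.of_eq (by simp)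

open HasValueAt RatFunc in
theorem isRegular_r4 (h : IsPolynomialIn (r4 α coord) (algebraMap Poly RatField G))
    (x y z w p : Coef) :
    IsRegular fun s => MvPolynomial.eval
      ![x, y, z, w, 1 / s, -s * (s * p + C (α 4))] G := by
  refine h.isRegular _ ![.C x, .C y, .C z, .C w, .X, .C p] fun s hs => ?_
  set a : Fin 6 → Coef :=
    ![x, y, z, w, 1 / s, -s * (s * p + C (α 4))]
  have h0 : HasValueAt a (coord 0) (x) := of_coord a 0
  have h1 : HasValueAt a (coord 1) (y) := of_coord a 1
  have h2 : HasValueAt a (coord 2) (z) := of_coord a 2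
  have h3 : HasValueAt a (coord 3) (w) := of_coord a 3
  have h4 : HasValueAt a (coord 4) (1 / s) := of_coord a 4
  have h5 : HasValueAt a (coord 5) (-s * (s * p + C (α 4))) := of_coord a 5
  intro i
  match i with
  | 0 => exact h0.of_eq (by simp)
  | 1 => exact h1.of_eq (by simp)
  | 2 => exact h2.of_eq (by simp)
  | 3 => exact h3.of_eq (by simp)
  | 4 =>
    change HasValueAt a _ (Polynomial.eval s Polynomial.X)
    refine ((HasValueAt.one a).div h4 (one_div_ne_zero hs)).of_eq ?_
    rw [Polynomial.eval_X]
    field_simp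
    try ring
  | 5 =>
    change HasValueAt a _ (Polynomial.eval s (Polynomial.C p))
    refine ((((h5.mul h4).add (of_coef a (C (α 4)))).neg).mul h4).of_eq ?_
    rw [Polynomial.eval_C]
    field_simp
    try ring

open HasValueAt RatFunc in
theorem isRegular_r5 (h : IsPolynomialIn (r5 α coord) (algebraMap Poly RatField G))
    (x y z w p : Coef) :
    IsRegular fun s => MvPolynomial.eval
      ![x, y, z, w, 1 / s, t - s * (s * p + C (α 5))] G := by
  refine h.isRegular _ ![.C x, .C y, .C z, .C w, .X, .C p] fun s hs => ?_
  set a : Fin 6 → Coef :=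
    ![x, y, z, w, 1 / s, t - s * (s * p + C (α 5))]
  have h0 : HasValueAt a (coord 0) (x) := of_coord a 0
  have h1 : HasValueAt a (coord 1) (y) := of_coord a 1
  have h2 : HasValueAt a (coord 2) (z) := of_coord a 2
  have h3 : HasValueAt a (coord 3) (w) := of_coord a 3
  have h4 : HasValueAt a (coord 4) (1 / s) := of_coord a 4
  have h5 : HasValueAt a (coord 5) (t - s * (s * p + C (α 5))) := of_coord a 5
  intro i
  match i with
  | 0 => exact h0.of_eq (by simp)
  | 1 => exact h1.of_eq (by simp)
  | 2 => exact h2.of_eq (by simp)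
  | 3 => exact h3.of_eq (by simp)
  | 4 =>
    change HasValueAt a _ (Polynomial.eval s Polynomial.X)
    refine ((HasValueAt.one a).div h4 (one_div_ne_zero hs)).of_eq ?_
    rw [Polynomial.eval_X]
    field_simp
    try ring
  | 5 =>
    change HasValueAt a _ (Polynomial.eval s (Polynomial.C p))
    refine (((((h5.sub (of_coef a t)).mul h4).add (of_coef a (C (α 5)))).neg).mul h4).of_eq ?_
    rw [Polynomial.eval_C]
    field_simp
    try ring

-- Two inversions are composed: `r₃` is solved for the `r₄` coordinates, with `p₄ = p - 1 / s`, and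
-- then `r₄` for the original ones. The latter needs `q₄ = q ≠ 0`.
open HasValueAt RatFunc in
theorem isRegular_r3_r4 (h : IsPolynomialIn (r3 α (r4 α coord)) (algebraMap Poly RatField G))
    (x y z q p : Coef) (hq : q ≠ 0) :
    IsRegular fun s => MvPolynomial.eval
      ![x, y, q + C (α 3) * s - z * s ^ 2, 1 / s, 1 / q, -q * (q * (p - 1 / s) + C (α 4))] G := by
  refine h.isRegular _ ![.C x, .C y, .C z, .X, .C q, .C p] fun s hs => ?_
  set a : Fin 6 → Coef :=
    ![x, y, q + C (α 3) * s - z * s ^ 2, 1 / s, 1 / q, -q * (q * (p - 1 / s) + C (α 4))]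
  have h0 : HasValueAt a (coord 0) (x) := of_coord a 0
  have h1 : HasValueAt a (coord 1) (y) := of_coord a 1
  have h2 : HasValueAt a (coord 2) (q + C (α 3) * s - z * s ^ 2) := of_coord a 2
  have h3 : HasValueAt a (coord 3) (1 / s) := of_coord a 3
  have h4 : HasValueAt a (coord 4) (1 / q) := of_coord a 4
  have h5 : HasValueAt a (coord 5) (-q * (q * (p - 1 / s) + C (α 4))) := of_coord a 5
  have h6 := (HasValueAt.one a).div h4 (one_div_ne_zero hq)
  have h7 := (((h5.mul h4).add (of_coef a (C (α 4)))).neg).mul h4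
  intro i
  match i with
  | 0 => exact h0.of_eq (by simp)
  | 1 => exact h1.of_eq (by simp)
  | 2 =>
    change HasValueAt a _ (Polynomial.eval s (Polynomial.C z))
    refine (((((h2.sub h6).mul h3).sub (of_coef a (C (α 3)))).neg).mul h3).of_eq ?_
    rw [Polynomial.eval_C]
    field_simp
    try ring
  | 3 =>
    change HasValueAt a _ (Polynomial.eval s Polynomial.X)
    refine ((HasValueAt.one a).div h3 (one_div_ne_zero hs)).of_eq ?_
    rw [Polynomial.eval_X]
    field_simp
    try ring
  | 4 =>
    change HasValueAt a _ (Polynomial.eval s (Polynomial.C q))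
    refine (h6).of_eq ?_
    rw [Polynomial.eval_C]
    field_simp
    try ring
  | 5 =>
    change HasValueAt a _ (Polynomial.eval s (Polynomial.C p))
    refine (h7.add h3).of_eq ?_
    rw [Polynomial.eval_C]
    field_simp
    try ring

end Curves

/-! ### Expansion in monomials -/

/-- The pairs of exponents at most `4`. -/
def expBox : Finset (ℕ × ℕ) := Finset.range 5 ×ˢ Finset.range 5

theorem mem_expBox {m : ℕ × ℕ} : m ∈ expBox ↔ m.1 < 5 ∧ m.2 < 5 := by
  simp [expBox]

theorem sum_expBox {F : Type*} [Field F] {f : ℕ × ℕ → F}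
    (hf : ∀ m : ℕ × ℕ, 4 < m.1 + m.2 → f m = 0) (a b : F) :
    ∑ m ∈ expBox, f m * (a ^ m.1 * b ^ m.2) =
      f (0, 0) + f (0, 1) * b + f (0, 2) * b ^ 2 + f (0, 3) * b ^ 3 + f (0, 4) * b ^ 4
      + a * (f (1, 0) + f (1, 1) * b + f (1, 2) * b ^ 2 + f (1, 3) * b ^ 3)
      + a ^ 2 * (f (2, 0) + f (2, 1) * b + f (2, 2) * b ^ 2)
      + a ^ 3 * (f (3, 0) + f (3, 1) * b) + a ^ 4 * f (4, 0) := by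
  simp only [expBox, Finset.sum_product, Finset.sum_range_succ, Finset.sum_range_zero,
    hf (1, 4) (by norm_num), hf (2, 3) (by norm_num), hf (2, 4) (by norm_num),
    hf (3, 2) (by norm_num), hf (3, 3) (by norm_num), hf (3, 4) (by norm_num),
    hf (4, 1) (by norm_num), hf (4, 2) (by norm_num), hf (4, 3) (by norm_num),
    hf (4, 4) (by norm_num)]
  ring

theorem exists_coeff {G : Poly} (hG : G.totalDegree = 4) :
    ∃ c : ℕ × ℕ → ℕ × ℕ → ℕ × ℕ → Coef,
      (∀ m n o, 4 < m.1 + m.2 + (n.1 + n.2) + (o.1 + o.2) → c m n o = 0) ∧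
      ∀ x y z w q p, MvPolynomial.eval ![x, y, z, w, q, p] G =
        ∑ o ∈ expBox, (∑ n ∈ expBox, (∑ m ∈ expBox, c m n o * (x ^ m.1 * y ^ m.2)) *
          (z ^ n.1 * w ^ n.2)) * (q ^ o.1 * p ^ o.2) := by
  -- The pairs are taken in the order `(q, p)`, `(z, w)`, `(x, y)`, to match the nesting of the
  -- sums.
  let e : (ℕ × ℕ) × (ℕ × ℕ) × (ℕ × ℕ) → (Fin 6 →₀ ℕ) := fun r =>
    Finsupp.equivFunOnFinite.symm ![r.2.2.1, r.2.2.2, r.2.1.1, r.2.1.2, r.1.1, r.1.2]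
  have he : Function.Injective e := by
    rintro ⟨⟨a, b⟩, ⟨c, d⟩, ⟨f, g⟩⟩ ⟨⟨a', b'⟩, ⟨c', d'⟩, ⟨f', g'⟩⟩ h
    have h := Finsupp.equivFunOnFinite.symm.injective h
    simp only [Matrix.vecCons_inj] at h
    simp [h]
  have hdeg : ∀ r, (e r).sum (fun _ k => k) =
      r.2.2.1 + r.2.2.2 + (r.2.1.1 + r.2.1.2) + (r.1.1 + r.1.2) := by
    intro r
    rw [Finsupp.sum_fintype _ _ (by simp)]
    simp [e, Fin.sum_univ_six]
    ring
  refine ⟨fun m n o => MvPolynomial.coeff (e (o, n, m)) G, fun m n o h => ?_, ?_⟩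
  · apply MvPolynomial.coeff_eq_zero_of_totalDegree_lt
    have := hdeg (o, n, m)
    simp only [Finsupp.sum] at this
    omega
  · intro x y z w q p
    have hS : G.support ⊆ (expBox ×ˢ expBox ×ˢ expBox).image e := by
      intro d hd
      have h4 : d.sum (fun _ k => k) ≤ 4 := hG ▸ MvPolynomial.le_totalDegree hd
      rw [Finsupp.sum_fintype _ _ (by simp)] at h4
      simp only [Fin.sum_univ_six] at h4
      refine Finset.mem_image.2 ⟨((d 4, d 5), (d 2, d 3), (d 0, d 1)), ?_, ?_⟩
      · simp only [Finset.mem_product, mem_expBox]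
        omega
      · ext i
        fin_cases i <;> simp [e]
    rw [MvPolynomial.eval_eq', Finset.sum_subset hS fun d _ hd => by
      rw [MvPolynomial.notMem_support_iff.1 hd, zero_mul], Finset.sum_image fun _ _ _ _ h => he h]
    simp only [Finset.sum_product, Finset.sum_mul]
    refine Finset.sum_congr rfl fun o _ => Finset.sum_congr rfl fun n _ =>
      Finset.sum_congr rfl fun m _ => ?_
    simp [e, Fin.prod_univ_six]
    ring

/-! ### Polar parts -/

namespace IsRegular

variable {F : Type*} [Field F] [Infinite F] {f g : F → F}

/-- The coefficients of a regular family of polynomials in two variables are regular. -/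
theorem coeff_pair {g : ℕ × ℕ → F → F}
    (h : ∀ v w, IsRegular fun s => ∑ m ∈ expBox, g m s * (v ^ m.1 * w ^ m.2)) :
    ∀ m ∈ expBox, IsRegular (g m) := by
  rintro ⟨i, j⟩ hm
  obtain ⟨hi, hj⟩ := mem_expBox.1 hm
  refine coeff (n := 5) (g := fun j => g (i, j)) (fun w => ?_) j hj
  refine coeff (n := 5) (g := fun i s => ∑ j ∈ Finset.range 5, g (i, j) s * w ^ j)
    (fun v => (h v w).congr fun s _ => ?_) i hi
  simp only [expBox, Finset.sum_product, Finset.sum_mul]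
  exact Finset.sum_congr rfl fun _ _ => Finset.sum_congr rfl fun _ _ => by ring

theorem polar_part_eight {c1 c2 c3 c4 c5 c6 c7 c8 : F} (hf : IsRegular f) (hg : IsRegular g)
    (h : ∀ s, s ≠ 0 → f s = g s + (c1 / s + c2 / s ^ 2 + c3 / s ^ 3 + c4 / s ^ 4
      + c5 / s ^ 5 + c6 / s ^ 6 + c7 / s ^ 7 + c8 / s ^ 8)) :
    c1 = 0 ∧ c2 = 0 ∧ c3 = 0 ∧ c4 = 0 ∧ c5 = 0 ∧ c6 = 0 ∧ c7 = 0 ∧ c8 = 0 := by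
  have key := principal_part_eq_zero (n := 8)
    (c := fun i => [c1, c2, c3, c4, c5, c6, c7, c8].getD i 0)
    ((hf.sub hg).congr fun s hs => by
      simp [h s hs, Finset.sum_range_succ])
  exact ⟨key 0 (by norm_num), key 1 (by norm_num), key 2 (by norm_num), key 3 (by norm_num),
    key 4 (by norm_num), key 5 (by norm_num), key 6 (by norm_num), key 7 (by norm_num)⟩

theorem polar_part_four {c1 c2 c3 c4 : F} (hf : IsRegular f) (hg : IsRegular g)
    (h : ∀ s, s ≠ 0 → f s = g s + (c1 / s + c2 / s ^ 2 + c3 / s ^ 3 + c4 / s ^ 4)) :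
    c1 = 0 ∧ c2 = 0 ∧ c3 = 0 ∧ c4 = 0 := by
  obtain ⟨h1, h2, h3, h4, -⟩ := polar_part_eight (c1 := c1) (c2 := c2)
    (c3 := c3) (c4 := c4) (c5 := 0) (c6 := 0) (c7 := 0) (c8 := 0) hf hg
    (fun s hs => by rw [h s hs]; ring)
  exact ⟨h1, h2, h3, h4⟩

/-- A function of two variables, regular along `x - 2 β / s - 1 / s ^ 2, s`. -/
theorem r0_relations {f : ℕ × ℕ → F} (hf : ∀ m : ℕ × ℕ, 4 < m.1 + m.2 → f m = 0) {β : F}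
    (h : IsRegular fun s => ∑ m ∈ expBox,
      f m * ((0 - 2 * β / s - 1 / s ^ 2) ^ m.1 * s ^ m.2)) :
    f (4, 0) = 0 ∧ f (3, 0) = 0 ∧ f (3, 1) = 0 ∧ f (2, 0) = 0 ∧ f (2, 1) = 0 ∧
      f (1, 0) = f (2, 2) ∧ f (1, 1) = 2 * β * f (2, 2) := by
  simp only [sum_expBox hf] at h
  -- Laurent expansion in `s`: `g` is the polynomial part. The equations are then solved from the
  -- deepest pole upwards.
  obtain ⟨h1, h2, h3, h4, h5, h6, h7, h8⟩ := polar_part_eight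
    (g := fun s => 4 * β ^ 2 * f (2, 2) - 2 * β * f (1, 1) - f (1, 2) * (2 * β * s + 1)
      - f (1, 3) * s * (2 * β * s + 1)
      + (f (0, 0) + f (0, 1) * s + f (0, 2) * s ^ 2 + f (0, 3) * s ^ 3 + f (0, 4) * s ^ 4))
    (c1 := 4 * β ^ 2 * f (2, 1) + 4 * β * f (2, 2) - 2 * β * f (1, 0) - f (1, 1))
    (c2 := -8 * β ^ 3 * f (3, 1) + 4 * β ^ 2 * f (2, 0) + 4 * β * f (2, 1) + f (2, 2) - f (1, 0))
    (c3 := -8 * β ^ 3 * f (3, 0) - 12 * β ^ 2 * f (3, 1) + 4 * β * f (2, 0) + f (2, 1))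
    (c4 := 16 * β ^ 4 * f (4, 0) - 12 * β ^ 2 * f (3, 0) - 6 * β * f (3, 1) + f (2, 0))
    (c5 := 32 * β ^ 3 * f (4, 0) - 6 * β * f (3, 0) - f (3, 1))
    (c6 := 24 * β ^ 2 * f (4, 0) - f (3, 0)) (c7 := 8 * β * f (4, 0)) (c8 := f (4, 0)) h
    (by fun_prop) (fun s hs => by field_simp; ring)
  have e1 : f (3, 0) = 0 := by linear_combination 24 * β ^ 2 * h8 - h6
  have e2 : f (3, 1) = 0 := by linear_combination 32 * β ^ 3 * h8 - 6 * β * e1 - h5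
  have e3 : f (2, 0) = 0 := by
    linear_combination h4 - 16 * β ^ 4 * h8 + 12 * β ^ 2 * e1 + 6 * β * e2
  have e4 : f (2, 1) = 0 := by
    linear_combination h3 + 8 * β ^ 3 * e1 + 12 * β ^ 2 * e2 - 4 * β * e3
  have e5 : f (1, 0) = f (2, 2) := by
    linear_combination -h2 - 8 * β ^ 3 * e2 + 4 * β ^ 2 * e3 + 4 * β * e4
  exact ⟨h8, e1, e2, e3, e4, e5, by linear_combination -h1 + 4 * β ^ 2 * e4 - 2 * β * e5⟩

/-- A function of two variables, regular along `1 / s, -s * (s * w + β)`. -/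
theorem r2_relations {f : ℕ × ℕ → F} (hf : ∀ m : ℕ × ℕ, 4 < m.1 + m.2 → f m = 0) {β : F}
    (h : ∀ w, IsRegular fun s => ∑ m ∈ expBox,
      f m * ((1 / s) ^ m.1 * (-s * (s * w + β)) ^ m.2)) :
    f (4, 0) = 0 ∧ f (3, 0) = 0 ∧ f (3, 1) = 0 ∧ f (2, 0) = 0 ∧ f (1, 0) = β * f (2, 1) := by
  simp only [sum_expBox hf] at h
  have key : ∀ w, f (1, 0) - β * f (2, 1) - w * f (3, 1) = 0 ∧ f (2, 0) - β * f (3, 1) = 0 ∧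
      f (3, 0) = 0 ∧ f (4, 0) = 0 := by
    intro w
    refine polar_part_four
      (g := fun s => -w * f (2, 1) + (s * w + β) ^ 2 * f (2, 2) - (s * w + β) * f (1, 1)
        + s * (s * w + β) ^ 2 * f (1, 2) - s ^ 2 * (s * w + β) ^ 3 * f (1, 3)
        + (f (0, 0) + f (0, 1) * (-(s * (s * w + β))) + f (0, 2) * (-(s * (s * w + β))) ^ 2
        + f (0, 3) * (-(s * (s * w + β))) ^ 3 + f (0, 4) * (-(s * (s * w + β))) ^ 4)) (h w)
      (by fun_prop) (fun s hs => by field_simp; ring)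
  -- Comparing the residues at `w = 0` and `w = 1` isolates `f (3, 1)`.
  obtain ⟨h1, h2, h3, h4⟩ := key 0
  have e1 : f (3, 1) = 0 := by linear_combination h1 - (key 1).1
  exact ⟨h4, h3, e1, by linear_combination h2 + β * e1, by linear_combination h1⟩

/-- A function of two variables whose sum with the first variable is regular along
`1 / s, τ - s * (s * w + β)`. -/
theorem r5_relations {f : ℕ × ℕ → F} (hf : ∀ m : ℕ × ℕ, 4 < m.1 + m.2 → f m = 0) {β γ τ : F}
    (hτ : τ ≠ 0)
    (h4 : f (4, 0) = 0 ∧ f (3, 0) = 0 ∧ f (3, 1) = 0 ∧ f (2, 0) = 0 ∧ f (1, 0) = γ * f (2, 1))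
    (h : IsRegular fun s => ∑ m ∈ expBox,
      f m * ((1 / s) ^ m.1 * (τ - s * (s * 0 + β)) ^ m.2) + 1 / s) :
    f (2, 1) = -τ * f (2, 2) ∧
      f (1, 1) = (β + γ) * f (2, 2) - τ * f (1, 2) - τ ^ 2 * f (1, 3) - 1 / τ := by
  obtain ⟨e1, e2, e3, e4, e5⟩ := h4
  simp only [sum_expBox hf, e1, e2, e3, e4] at h
  -- The final `+ 1` in `c1` is the residue of the added `1 / s`; it is the source of the
  -- inhomogeneous term `-1 / τ`.
  obtain ⟨h1, h2, -, -⟩ := polar_part_four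
    (g := fun s => β ^ 2 * f (2, 2) - β * f (1, 1) + f (1, 2) * (s * β ^ 2 - 2 * τ * β)
      + f (1, 3) * (3 * τ * s * β ^ 2 - 3 * τ ^ 2 * β - s ^ 2 * β ^ 3)
      + (f (0, 0) + f (0, 1) * (τ - s * β) + f (0, 2) * (τ - s * β) ^ 2
      + f (0, 3) * (τ - s * β) ^ 3 + f (0, 4) * (τ - s * β) ^ 4))
    (c1 := -β * (f (2, 1) + 2 * τ * f (2, 2)) + f (1, 0) + f (1, 1) * τ + f (1, 2) * τ ^ 2
      + f (1, 3) * τ ^ 3 + 1)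
    (c2 := τ * f (2, 1) + τ ^ 2 * f (2, 2)) (c3 := 0) (c4 := 0) h
    (by fun_prop) (fun s hs => by field_simp; ring)
  have e6 : f (2, 1) = -τ * f (2, 2) := by
    apply mul_left_cancel₀ hτ
    linear_combination h2
  refine ⟨e6, ?_⟩
  rw [e5, e6] at h1
  field_simp
  linear_combination h1

end IsRegular

/-! ### Identities in a free parameter, and the chart `r₁` -/

namespace IsRegular

variable {F : Type*} [Field F] [Infinite F] {f g : F → F}

/-- With `v = 1 / s`, dividing by `s` turns the polynomial into a polar part that is identically
zero. -/
theorem eq_zero_of_forall_eight {c0 c1 c2 c3 c4 c5 c6 c7 : F}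
    (h : ∀ v, v ≠ 0 → c0 + c1 * v + c2 * v ^ 2 + c3 * v ^ 3 + c4 * v ^ 4 + c5 * v ^ 5
      + c6 * v ^ 6 + c7 * v ^ 7 = 0) :
    c0 = 0 ∧ c1 = 0 ∧ c2 = 0 ∧ c3 = 0 ∧ c4 = 0 ∧ c5 = 0 ∧ c6 = 0 ∧ c7 = 0 := by
  refine polar_part_eight (const 0) (const 0) fun s hs => ?_
  have := h (1 / s) (one_div_ne_zero hs)
  field_simp at this ⊢
  linear_combination -this

theorem eq_zero_of_forall_four {c0 c1 c2 c3 : F}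
    (h : ∀ v, v ≠ 0 → c0 + c1 * v + c2 * v ^ 2 + c3 * v ^ 3 = 0) :
    c0 = 0 ∧ c1 = 0 ∧ c2 = 0 ∧ c3 = 0 := by
  obtain ⟨h0, h1, h2, h3, -⟩ := eq_zero_of_forall_eight (c0 := c0) (c1 := c1) (c2 := c2)
    (c3 := c3) (c4 := 0) (c5 := 0) (c6 := 0) (c7 := 0) fun v hv => by linear_combination h v hv
  exact ⟨h0, h1, h2, h3⟩

theorem coeff_quadratic {g0 g1 g2 : F → F}
    (h : ∀ v, IsRegular fun s => g0 s + g1 s * v + g2 s * v ^ 2) :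
    IsRegular g0 ∧ IsRegular g1 ∧ IsRegular g2 := by
  have key := coeff (n := 3) (g := fun i => [g0, g1, g2].getD i 0) fun v =>
    (h v).congr fun s _ => by simp [Finset.sum_range_succ]
  exact ⟨key 0 (by norm_num), key 1 (by norm_num), key 2 (by norm_num)⟩

/-- A combination of products of functions regular in the charts `r₀` and `r₂` which is also
regular in the chart `r₁`. -/
theorem r1_relations {a0 a1 a2 p00 p10 p01 p20 p11 p02 p30 p21 p12 p03 p40 p31 p22 p13 p04 m0 m1 m2 h
      g00 g10 g01 g20 g11 g02 n l0 l1 : F}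
    (hreg : ∀ x z w, IsRegular fun s =>
        (p00)
        + (p10 * (1 / s) + p01 * (w - 1 / s))
        + (p20 * (1 / s) ^ 2 + p11 * (1 / s) * (w - 1 / s) + p02 * (w - 1 / s) ^ 2)
        + (p30 * (1 / s) ^ 3 + p21 * (1 / s) ^ 2 * (w - 1 / s) + p12 * (1 / s) * (w
          - 1 / s) ^ 2 + p03 * (w - 1 / s) ^ 3)
        + (p40 * (1 / s) ^ 4 + p31 * (1 / s) ^ 3 * (w - 1 / s) + p22 * (1 / s) ^ 2 * (w
          - 1 / s) ^ 2 + p13 * (1 / s) * (w - 1 / s) ^ 3 + p04 * (w - 1 / s) ^ 4)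
        + (z + a1 * s - x * s ^ 2) * (1 / s) ^ 2 * (m0 + m1 * (1 / s) + m2 * (w - 1 / s))
        + h * ((z + a1 * s - x * s ^ 2) ^ 2 * (1 / s) ^ 2 + 2 * a0 * (z + a1 * s
          - x * s ^ 2) * (1 / s) + (z + a1 * s - x * s ^ 2))
        + z * (w - 1 / s) * (g00 + g10 * (1 / s) + g01 * (w - 1 / s) + g20 * (1 / s) ^ 2
          + g11 * (1 / s) * (w - 1 / s) + g02 * (w - 1 / s) ^ 2)
        + n * z ^ 2 * (w - 1 / s) ^ 2 + (z ^ 2 * (w - 1 / s) + a2 * z) * (l0 + l1 * (1 / s))) :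
    ((m2 = m1 ∧ n = h ∧ l0 = 0 ∧ l1 = 2 * h) ∧
      (g00 = 2 * (a0 + a1 + a2) * h ∧ g10 = 2 * m0 ∧ g01 = m0 ∧ g20 = 2 * m1 ∧ g11 = 3 * m1 ∧
        g02 = m1)) ∧
    ((p10 = p01 - a1 * m0 ∧ p20 = p02 - a1 * m1 ∧ p11 = 2 * p02 - a1 * m1) ∧
      (p30 = p03 ∧ p21 = 3 * p03 ∧ p12 = 3 * p03) ∧
      (p40 = p04 ∧ p31 = 4 * p04 ∧ p22 = 6 * p04 ∧ p13 = 4 * p04)) := by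
  -- Along the curve the function is quadratic in the constant `z`, so its three coefficients are
  -- regular separately. Their polar parts are then compared as polynomials in `w`, and once in `x`.
  have hz : ∀ x w,
      IsRegular (fun s => ((p00) + (p01) * w + (p02) * w ^ 2 + (p03) * w ^ 3 + (p04) * w ^ 4
        + ((p10 - p01) + (p11 - 2 * p02) * w + (p12 - 3 * p03) * w ^ 2 + (p13
        - 4 * p04) * w ^ 3) * (1 / s)
          + ((p20 - p11 + p02) + (p21 - 2 * p12 + 3 * p03) * w + (p22 - 3 * p13
            + 6 * p04) * w ^ 2) * (1 / s) ^ 2 + ((p30 - p21 + p12 - p03) + (p31 - 2 * p22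
            + 3 * p13 - 4 * p04) * w) * (1 / s) ^ 3
          + ((p40 - p31 + p22 - p13 + p04)) * (1 / s) ^ 4)
        + (a1 * (1 / s) - x) * (m0 + m1 * (1 / s) + m2 * (w - 1 / s))
        + h * ((a1 - x * s) ^ 2 + 2 * a0 * (a1 - x * s) + a1 * s - x * s ^ 2)) ∧
      IsRegular (fun s => (m1 - m2 - (g20 - g11 + g02)) * (1 / s) ^ 3
        + (m0 + m2 * w + w * (g20 - g11 + g02) - (g10 - g01 + g11 * w - 2 * g02 * w)) * (1 / s) ^ 2
        + (2 * h * (a0 + a1) + w * (g10 - g01 + g11 * w - 2 * g02 * w)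
          - (g00 + g01 * w + g02 * w ^ 2) + a2 * l1) * (1 / s)
        + (h * (1 - 2 * x) + w * (g00 + g01 * w + g02 * w ^ 2) + a2 * l0)) ∧
      IsRegular (fun s => (h + n - l1) * (1 / s) ^ 2 + (-2 * n * w - l0 + l1 * w) * (1 / s)
        + (n * w ^ 2 + l0 * w)) := fun x w =>
    coeff_quadratic fun z => (hreg x z w).congr fun s hs => by field_simp; ring
  have q2 : ∀ w, -2 * n * w - l0 + l1 * w = 0 ∧ h + n - l1 = 0 ∧ (0 : F) = 0 ∧ (0 : F) = 0 :=
    fun w => polar_part_four (hz 0 w).2.2 (const (n * w ^ 2 + l0 * w)) fun s hs => by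
      field_simp; ring
  have q1 : ∀ w, 2 * h * (a0 + a1) + w * (g10 - g01 + g11 * w - 2 * g02 * w)
      - (g00 + g01 * w + g02 * w ^ 2) + a2 * l1 = 0 ∧
      m0 + m2 * w + w * (g20 - g11 + g02) - (g10 - g01 + g11 * w - 2 * g02 * w) = 0 ∧
      m1 - m2 - (g20 - g11 + g02) = 0 ∧ (0 : F) = 0 :=
    fun w => polar_part_four (hz 0 w).2.1
      (const (h * (1 - 2 * 0) + w * (g00 + g01 * w + g02 * w ^ 2) + a2 * l0)) fun s hs => by
      field_simp; ring
  have q0 : ∀ x w, (p10 - p01) + (p11 - 2 * p02) * w + (p12 - 3 * p03) * w ^ 2 + (p13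
    - 4 * p04) * w ^ 3 + a1 * (m0 + m2 * w) - x * (m1 - m2) = 0 ∧
      (p20 - p11 + p02) + (p21 - 2 * p12 + 3 * p03) * w + (p22 - 3 * p13 + 6 * p04) * w ^ 2
        + a1 * (m1 - m2) = 0 ∧
      (p30 - p21 + p12 - p03) + (p31 - 2 * p22 + 3 * p13 - 4 * p04) * w = 0 ∧
      (p40 - p31 + p22 - p13 + p04) = 0 :=
    fun x w => polar_part_four (hz x w).1
      (g := fun s => (p00) + (p01) * w + (p02) * w ^ 2 + (p03) * w ^ 3 + (p04) * w ^ 4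
        - x * (m0 + m2 * w)
        + h * ((a1 - x * s) ^ 2 + 2 * a0 * (a1 - x * s) + a1 * s - x * s ^ 2)) (by fun_prop)
      fun s hs => by field_simp; ring
  have em : m2 = m1 := by linear_combination (q0 1 0).1 - (q0 0 0).1
  subst em
  have el0 : l0 = 0 := by linear_combination -(q2 0).1
  have el1 : l1 = 2 * n := by linear_combination (q2 1).1 + el0
  have en : n = h := by linear_combination -(q2 0).2.1 - el1
  have G2 := (q1 0).2.2.1
  have G1 := eq_zero_of_forall_four (c0 := m0 - (g10 - g01)) (c1 := m2 - (g11 - 2 * g02)) (c2 := 0)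
    (c3 := 0) fun w _ => by linear_combination (q1 w).2.1 + w * G2
  have G0 := eq_zero_of_forall_four (c0 := 2 * h * (a0 + a1) + a2 * l1 - g00)
    (c1 := g10 - g01 - g01) (c2 := g11 - 2 * g02 - g02) (c3 := 0)
    fun w _ => by linear_combination (q1 w).1
  have P1 := eq_zero_of_forall_four (c0 := p10 - p01 + a1 * m0) (c1 := p11 - 2 * p02 + a1 * m2)
    (c2 := p12 - 3 * p03) (c3 := p13 - 4 * p04) fun w _ => by linear_combination (q0 0 w).1
  have P2 := eq_zero_of_forall_four (c0 := p20 - p11 + p02) (c1 := p21 - 2 * p12 + 3 * p03)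
    (c2 := p22 - 3 * p13 + 6 * p04) (c3 := 0) fun w _ => by linear_combination (q0 0 w).2.1
  have P3 := eq_zero_of_forall_four (c0 := p30 - p21 + p12 - p03)
    (c1 := p31 - 2 * p22 + 3 * p13 - 4 * p04) (c2 := 0) (c3 := 0)
    fun w _ => by linear_combination (q0 0 w).2.2.1
  have P4 := (q0 0 0).2.2.2
  obtain ⟨G10, G11, -⟩ := G1
  obtain ⟨G00, G01, G02, -⟩ := G0
  obtain ⟨P10, P11, P12, P13⟩ := P1
  obtain ⟨P20, P21, P22, -⟩ := P2
  obtain ⟨P30, P31, -⟩ := P3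
  refine ⟨⟨⟨rfl, en, el0, ?_⟩, ?_, ?_, ?_, ?_, ?_, ?_⟩, ⟨?_, ?_, ?_⟩, ⟨?_, ?_, ?_⟩, ?_, ?_, ?_, ?_⟩
  · linear_combination el1 + 2 * en
  · linear_combination -G00 + a2 * el1 + 2 * a2 * en
  · linear_combination -2 * G10 - G01
  · linear_combination -G10 - G01
  · linear_combination -G2 - 2 * G11 - G02
  · linear_combination -3 * G11 - 2 * G02
  · linear_combination -G11 - G02
  · linear_combination P10
  · linear_combination P20 + P11
  · linear_combination P11
  · linear_combination P30 + P21 + P12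
  · linear_combination P21 + 2 * P12
  · linear_combination P12
  · linear_combination P4 + P31 + P22 + P13
  · linear_combination P31 + 2 * P22 + 3 * P13
  · linear_combination P22 + 3 * P13
  · linear_combination P13

end IsRegular

/-! ### Normal form in `x, y, z, w` from the charts `r₀`, `r₁`, `r₂` -/

section NormalForm

variable {F : Type*} [Field F] {a0 a1 a2 : F} {e : ℕ × ℕ → ℕ × ℕ → F}

/-- The relations leave independent coefficients only; the dependent ones are absorbed into `x ^ 2 *
y ^ 2 + 2 * a0 * x * y + x` and `z ^ 2 * w + a2 * z`, whose poles cancel in `r₀` and `r₂`. -/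
theorem sum_sum_expBox (he : ∀ m n : ℕ × ℕ, 4 < m.1 + m.2 + (n.1 + n.2) → e m n = 0)
    (h0 : ∀ n, e (4, 0) n = 0 ∧ e (3, 0) n = 0 ∧ e (3, 1) n = 0 ∧ e (2, 0) n = 0 ∧
      e (2, 1) n = 0 ∧ e (1, 0) n = e (2, 2) n ∧ e (1, 1) n = 2 * a0 * e (2, 2) n)
    (h2 : ∀ m, e m (4, 0) = 0 ∧ e m (3, 0) = 0 ∧ e m (3, 1) = 0 ∧ e m (2, 0) = 0 ∧
      e m (1, 0) = a2 * e m (2, 1)) (x y z w : F) :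
    ∑ n ∈ expBox, (∑ m ∈ expBox, e m n * (x ^ m.1 * y ^ m.2)) * (z ^ n.1 * w ^ n.2) =
        (e (0, 0) (0, 0))
        + (e (0, 1) (0, 0) * y + e (0, 0) (0, 1) * w)
        + (e (0, 2) (0, 0) * y ^ 2 + e (0, 1) (0, 1) * y * w + e (0, 0) (0, 2) * w ^ 2)
        + (e (0, 3) (0, 0) * y ^ 3 + e (0, 2) (0, 1) * y ^ 2 * w + e (0, 1) (0, 2) * y * w ^ 2
          + e (0, 0) (0, 3) * w ^ 3)
        + (e (0, 4) (0, 0) * y ^ 4 + e (0, 3) (0, 1) * y ^ 3 * w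
          + e (0, 2) (0, 2) * y ^ 2 * w ^ 2 + e (0, 1) (0, 3) * y * w ^ 3 + e (0, 0) (0, 4) * w ^ 4)
        + x * y ^ 2 * (e (1, 2) (0, 0) + e (1, 3) (0, 0) * y + e (1, 2) (0, 1) * w)
        + e (2, 2) (0, 0) * (x ^ 2 * y ^ 2 + 2 * a0 * x * y + x)
        + z * w * (e (0, 0) (1, 1) + e (0, 1) (1, 1) * y + e (0, 0) (1, 2) * w
          + e (0, 2) (1, 1) * y ^ 2 + e (0, 1) (1, 2) * y * w + e (0, 0) (1, 3) * w ^ 2)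
        + e (0, 0) (2, 2) * z ^ 2 * w ^ 2 + (z ^ 2 * w + a2 * z) * (e (0, 0) (2, 1)
          + e (0, 1) (2, 1) * y) := by
  have hn : ∀ n, ∑ m ∈ expBox, e m n * (x ^ m.1 * y ^ m.2) = _ := fun n =>
    sum_expBox (fun m hm => he m n (by omega)) x y
  rw [sum_expBox (f := fun n => ∑ m ∈ expBox, e m n * (x ^ m.1 * y ^ m.2)) fun n hn =>
    Finset.sum_eq_zero fun m _ => by rw [he m n (by omega), zero_mul]]
  simp only [hn]
  simp only [h0, h2]
  simp (disch := norm_num) only [he]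
  ring

/-- A combination of products of functions regular in the charts `r₀` and `r₂` which is also
regular in the chart `r₁`, in terms of the generators of the ring of such functions. -/
theorem sum_sum_eq_normalForm [Infinite F]
    (he : ∀ m n : ℕ × ℕ, 4 < m.1 + m.2 + (n.1 + n.2) → e m n = 0)
    (h0 : ∀ n, e (4, 0) n = 0 ∧ e (3, 0) n = 0 ∧ e (3, 1) n = 0 ∧ e (2, 0) n = 0 ∧
      e (2, 1) n = 0 ∧ e (1, 0) n = e (2, 2) n ∧ e (1, 1) n = 2 * a0 * e (2, 2) n)
    (h2 : ∀ m, e m (4, 0) = 0 ∧ e m (3, 0) = 0 ∧ e m (3, 1) = 0 ∧ e m (2, 0) = 0 ∧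
      e m (1, 0) = a2 * e m (2, 1))
    (hreg : ∀ x z w, IsRegular fun s => ∑ n ∈ expBox, (∑ m ∈ expBox, e m n *
      ((z + a1 * s - x * s ^ 2) ^ m.1 * (1 / s) ^ m.2)) * (z ^ n.1 * (w - 1 / s) ^ n.2))
    (x y z w : F) :
    ∑ n ∈ expBox, (∑ m ∈ expBox, e m n * (x ^ m.1 * y ^ m.2)) * (z ^ n.1 * w ^ n.2) =
      e (0, 0) (0, 0) + e (0, 0) (0, 1) * (y + w) + e (0, 0) (0, 2) * (y + w) ^ 2
        + e (0, 0) (0, 3) * (y + w) ^ 3 + e (0, 0) (0, 4) * (y + w) ^ 4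
        + (e (1, 2) (0, 0) + e (1, 3) (0, 0) * (y + w))
          * (x * y ^ 2 - a1 * y + z * w * (2 * y + w))
        + e (2, 2) (0, 0) * (x ^ 2 * y ^ 2 + 2 * a0 * x * y + x + z ^ 2 * w ^ 2
          + 2 * y * z * (z * w + a2) + 2 * (a0 + a1 + a2) * z * w) := by
  simp only [sum_sum_expBox he h0 h2] at hreg ⊢
  obtain ⟨⟨⟨e1, e2, e3, e4⟩, e5, e6, e7, e8, e9, e10⟩, ⟨e11, e12, e13⟩, ⟨e14, e15, e16⟩,
    e17, e18, e19, e20⟩ := IsRegular.r1_relations hreg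
  rw [e1, e2, e3, e4, e5, e6, e7, e8, e9, e10, e11, e12, e13, e14, e15, e16, e17, e18, e19, e20]
  ring

end NormalForm

/-! ### Regularity of the coefficients -/

section Slices

open RatFunc

variable {α : Fin 6 → ℂ} {G : Poly} {c : ℕ × ℕ → ℕ × ℕ → ℕ × ℕ → Coef}

/-- The chart fixes `z, w, q, p`, so `coeff_pair`, applied twice, isolates the coefficient of each
monomial in them. -/
theorem slice_relations_r0 (h0 : IsPolynomialIn (r0 α coord) (algebraMap Poly RatField G))
    (hc : ∀ m n o, 4 < m.1 + m.2 + (n.1 + n.2) + (o.1 + o.2) → c m n o = 0)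
    (hG : ∀ x y z w q p, MvPolynomial.eval ![x, y, z, w, q, p] G =
        ∑ o ∈ expBox, (∑ n ∈ expBox, (∑ m ∈ expBox, c m n o * (x ^ m.1 * y ^ m.2)) *
          (z ^ n.1 * w ^ n.2)) * (q ^ o.1 * p ^ o.2)) (n o : ℕ × ℕ) :
    c (4, 0) n o = 0 ∧ c (3, 0) n o = 0 ∧ c (3, 1) n o = 0 ∧ c (2, 0) n o = 0 ∧
      c (2, 1) n o = 0 ∧ c (1, 0) n o = c (2, 2) n o ∧
      c (1, 1) n o = 2 * C (α 0) * c (2, 2) n o := by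
  by_cases hno : n ∈ expBox ∧ o ∈ expBox
  · refine IsRegular.r0_relations (f := fun m => c m n o) (fun m hm => hc m n o (by omega)) ?_
    refine IsRegular.coeff_pair (g := fun n s => ∑ m ∈ expBox, c m n o *
      ((0 - 2 * C (α 0) / s - 1 / s ^ 2) ^ m.1 * s ^ m.2)) (fun z w => ?_) n hno.1
    refine IsRegular.coeff_pair (g := fun o s => ∑ n ∈ expBox, (∑ m ∈ expBox, c m n o *
      ((0 - 2 * C (α 0) / s - 1 / s ^ 2) ^ m.1 * s ^ m.2)) * (z ^ n.1 * w ^ n.2))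
      (fun q p => ?_) o hno.2
    exact (isRegular_r0 h0 0 z w q p).congr fun s _ => hG _ _ _ _ _ _
  · have : ∀ m, c m n o = 0 := fun m => hc m n o (by
      simp only [mem_expBox] at hno
      omega)
    simp [this]

theorem slice_relations_r2 (h2 : IsPolynomialIn (r2 α coord) (algebraMap Poly RatField G))
    (hc : ∀ m n o, 4 < m.1 + m.2 + (n.1 + n.2) + (o.1 + o.2) → c m n o = 0)
    (hG : ∀ x y z w q p, MvPolynomial.eval ![x, y, z, w, q, p] G =
        ∑ o ∈ expBox, (∑ n ∈ expBox, (∑ m ∈ expBox, c m n o * (x ^ m.1 * y ^ m.2)) *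
          (z ^ n.1 * w ^ n.2)) * (q ^ o.1 * p ^ o.2)) (m o : ℕ × ℕ) :
    c m (4, 0) o = 0 ∧ c m (3, 0) o = 0 ∧ c m (3, 1) o = 0 ∧ c m (2, 0) o = 0 ∧
      c m (1, 0) o = C (α 2) * c m (2, 1) o := by
  by_cases hmo : m ∈ expBox ∧ o ∈ expBox
  · refine IsRegular.r2_relations (f := fun n => c m n o) (fun n hn => hc m n o (by omega))
      fun w => ?_
    refine IsRegular.coeff_pair (g := fun m s => ∑ n ∈ expBox, c m n o *
      ((1 / s) ^ n.1 * (-s * (s * w + C (α 2))) ^ n.2)) (fun x y => ?_) m hmo.1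
    refine IsRegular.coeff_pair (g := fun o s => ∑ m ∈ expBox, (∑ n ∈ expBox, c m n o *
      ((1 / s) ^ n.1 * (-s * (s * w + C (α 2))) ^ n.2)) * (x ^ m.1 * y ^ m.2))
      (fun q p => ?_) o hmo.2
    refine (isRegular_r2 h2 x y w q p).congr fun s _ => (hG _ _ _ _ _ _).trans ?_
    refine Finset.sum_congr rfl fun o _ => congrArg (· * _) ?_
    simp only [Finset.sum_mul]
    rw [Finset.sum_comm]
    exact Finset.sum_congr rfl fun _ _ => Finset.sum_congr rfl fun _ _ => by ring
  · have : ∀ n, c m n o = 0 := fun n => hc m n o (by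
      simp only [mem_expBox] at hmo
      omega)
    simp [this]

theorem isRegular_slice_r1 (h1 : IsPolynomialIn (r1 α coord) (algebraMap Poly RatField G))
    (hG : ∀ x y z w q p, MvPolynomial.eval ![x, y, z, w, q, p] G =
        ∑ o ∈ expBox, (∑ n ∈ expBox, (∑ m ∈ expBox, c m n o * (x ^ m.1 * y ^ m.2)) *
          (z ^ n.1 * w ^ n.2)) * (q ^ o.1 * p ^ o.2)) {o : ℕ × ℕ} (ho : o ∈ expBox)
    (x z w : Coef) :
    IsRegular fun s => ∑ n ∈ expBox, (∑ m ∈ expBox, c m n o *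
      ((z + C (α 1) * s - x * s ^ 2) ^ m.1 * (1 / s) ^ m.2)) * (z ^ n.1 * (w - 1 / s) ^ n.2) :=
  IsRegular.coeff_pair (g := fun o s => ∑ n ∈ expBox, (∑ m ∈ expBox, c m n o *
      ((z + C (α 1) * s - x * s ^ 2) ^ m.1 * (1 / s) ^ m.2)) * (z ^ n.1 * (w - 1 / s) ^ n.2))
    (fun q p => (isRegular_r1 h1 x z w q p).congr fun _ _ => hG _ _ _ _ _ _) o ho

end Slices

/-! ### The chart `r₃` -/

namespace IsRegular

variable {F : Type*} [Field F] [Infinite F] {f g : F → F}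

/-- If `f s * s` agrees with the polynomial `N`, and `f` is regular, then `N` vanishes at `0`. -/
theorem eval_zero (hf : IsRegular f) (N : Polynomial F)
    (h : ∀ s, s ≠ 0 → f s * s = N.eval s) : N.eval 0 = 0 := by
  obtain ⟨Q, hQ⟩ := hf
  have key : Q * Polynomial.X = N := by
    refine Polynomial.eq_of_infinite_eval_eq _ _ (Set.Infinite.mono (s := {0}ᶜ) ?_
      (Set.Finite.infinite_compl (Set.finite_singleton _)))
    intro s hs
    simp only [Set.mem_ofPred_eq, Polynomial.eval_mul, Polynomial.eval_X, ← h s hs, ← hQ s hs]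
  rw [← key]
  simp

theorem eq_zero_of_forall_even {c0 c1 c2 c3 c4 : F}
    (h : ∀ v, v ≠ 0 → c0 + c1 * v ^ 2 + c2 * v ^ 4 + c3 * v ^ 6 + c4 * v ^ 8 = 0) :
    c0 = 0 ∧ c1 = 0 ∧ c2 = 0 ∧ c3 = 0 ∧ c4 = 0 := by
  -- The interleaved zeros account for the missing odd powers of `v`.
  have key := principal_part_eq_zero (n := 9)
    (c := fun i => [c0, 0, c1, 0, c2, 0, c3, 0, c4].getD i 0)
    ((const 0).congr fun s hs => by
      have := h (1 / s) (one_div_ne_zero hs)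
      simp only [Finset.sum_range_succ, Finset.sum_range_zero, List.getD_cons_zero,
        List.getD_cons_succ]
      linear_combination (-1 / s) * this)
  exact ⟨key 0 (by norm_num), key 2 (by norm_num), key 4 (by norm_num), key 6 (by norm_num),
    key 8 (by norm_num)⟩

/-- A combination of products of functions regular in the other charts which is also
regular in the chart `r₃`. -/
theorem r3_relations {a0 a1 a2 a3 a4 a5 τ c00 c10 c20 c30 c40 c01 c11 c21 c31 c02 c12 c22 c03 c13
      c04 e0 e1 e2 h b0 b1 b3 k : F}
    (ha : 2 * a0 + 2 * a1 + 2 * a2 + 2 * a3 + a4 + a5 = 1) (hτ : τ ≠ 0)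
    (hreg : ∀ x y z q p, q ≠ 0 → IsRegular fun s =>
        c00 + c10 * (y + (1 / s)) + c20 * (y + (1 / s)) ^ 2 + c30 * (y + (1 / s)) ^ 3
          + c40 * (y + (1 / s)) ^ 4
        + (e0 + e1 * (y + (1 / s))) * (x * y ^ 2 - a1 * y + (q + a3 * s
          - z * s ^ 2) * (1 / s) * (2 * y + (1 / s)))
        + h * (x ^ 2 * y ^ 2 + 2 * a0 * x * y + x + (q + a3 * s - z * s ^ 2) ^ 2 * (1 / s) ^ 2
          + 2 * y * (q + a3 * s - z * s ^ 2) * ((q + a3 * s - z * s ^ 2) * (1 / s) + a2)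
            + 2 * (a0 + a1 + a2) * (q + a3 * s - z * s ^ 2) * (1 / s))
        + (c01 + c11 * (y + (1 / s)) + c21 * (y + (1 / s)) ^ 2 + c31 * (y + (1 / s)) ^ 3
          + e2 * (x * y ^ 2 - a1 * y + (q + a3 * s - z * s ^ 2) * (1 / s) * (2 * y
            + (1 / s)))) * (-q * (q * (p - 1 / s) + a4))
        + (c02 + c12 * (y + (1 / s)) + c22 * (y + (1 / s)) ^ 2) * (-q * (q * (p - 1 / s) + a4)) ^ 2
        + (c03 + c13 * (y + (1 / s))) * (-q * (q * (p - 1 / s) + a4)) ^ 3 + c04 * (-q * (q * (p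
          - 1 / s) + a4)) ^ 4
        + (b0 + b1 * (y + (1 / s))) * ((1 / q) * (-q * (q * (p - 1 / s) + a4)) ^ 2
          - τ * (1 / q) * (-q * (q * (p - 1 / s) + a4)))
        + b3 * ((1 / q) * (-q * (q * (p - 1 / s) + a4)) ^ 3 - τ ^ 2 * (1 / q) * (-q * (q * (p
          - 1 / s) + a4)))
        + k * ((1 / q) ^ 2 * (-q * (q * (p - 1 / s) + a4)) ^ 2
          - τ * (1 / q) ^ 2 * (-q * (q * (p - 1 / s) + a4)) - a4 * τ * (1 / q) + (a4
          + a5) * (1 / q) * (-q * (q * (p - 1 / s) + a4)))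
        - 1 / τ * (1 / q) * (-q * (q * (p - 1 / s) + a4))) :
    ((c20 = 0 ∧ c30 = 0 ∧ c40 = 0) ∧ (c01 = 0 ∧ c21 = 0 ∧ c31 = 0) ∧
      (c02 = 0 ∧ c12 = 0 ∧ c22 = 0) ∧ (c03 = 0 ∧ c13 = 0 ∧ c04 = 0)) ∧
    (e0 = 0 ∧ e1 = 0 ∧ e2 = 0) ∧ (b0 = 0 ∧ b1 = 0 ∧ b3 = 0) ∧
    (h = 1 / τ ∧ k = 1 / τ ∧ c10 = 1 ∧ c11 = -2 / τ) := by
  -- Subtracting the values at `x = 1` and `x = 0` leaves only terms containing `x`.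
  have hx : ∀ q, q ≠ 0 → e1 + e2 * q ^ 2 = 0 := fun q hq =>
    (polar_part_four (g := fun _ => e0 + e1 - a4 * q * e2 + h * (2 * a0 + 2))
      (c2 := 0) (c3 := 0) (c4 := 0) ((hreg 1 1 0 q 0 hq).sub (hreg 0 1 0 q 0 hq)) (const _)
      fun s hs => by field_simp; ring).1
  obtain ⟨rfl, -, rfl, -⟩ := eq_zero_of_forall_four (c0 := e1) (c1 := 0) (c2 := e2) (c3 := 0)
    fun q hq => by linear_combination hx q hq
  -- Poles of order four: on the curve with `x = y = z = p = 0`, the old `p` equals `(q ^ 2 - a4 * q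
  -- * s) / s`, and the polynomial below is the function times `s ^ 4`.
  obtain ⟨rfl, rfl, rfl, rfl, rfl⟩ := eq_zero_of_forall_even (c0 := c40) (c1 := c31) (c2 := c22)
    (c3 := c13) (c4 := c04) fun q hq => by
      have := ((hreg 0 0 0 q 0 hq).mul (id.pow 3)).eval_zero
        (.C c00 * .X ^ 4
          + .C c01 * (.C (q ^ 2) - .C (a4 * q) * .X) * .X ^ 3
          + .C c02 * (.C (q ^ 2) - .C (a4 * q) * .X) ^ 2 * .X ^ 2
          + .C c03 * (.C (q ^ 2) - .C (a4 * q) * .X) ^ 3 * .X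
          + .C c04 * (.C (q ^ 2) - .C (a4 * q) * .X) ^ 4
          + .C c10 * .X ^ 3
          + .C c11 * (.C (q ^ 2) - .C (a4 * q) * .X) * .X ^ 2
          + .C c12 * (.C (q ^ 2) - .C (a4 * q) * .X) ^ 2 * .X
          + .C c13 * (.C (q ^ 2) - .C (a4 * q) * .X) ^ 3
          + .C c20 * .X ^ 2
          + .C c21 * (.C (q ^ 2) - .C (a4 * q) * .X) * .X
          + .C c22 * (.C (q ^ 2) - .C (a4 * q) * .X) ^ 2
          + .C c30 * .X
          + .C c31 * (.C (q ^ 2) - .C (a4 * q) * .X)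
          + .C c40
          + .C e0 * (.C q + .C a3 * .X) * .X ^ 2
          + .C h * ((.C q + .C a3 * .X) ^ 2
            + .C (2 * (a0 + a1 + a2)) * (.C q + .C a3 * .X) * .X) * .X ^ 2
          + .C b0 * (.C q - .C a4 * .X) * ((.C (q ^ 2) - .C (a4 * q) * .X) - .C τ * .X) * .X ^ 2
          + .C b1 * (.C q - .C a4 * .X) * ((.C (q ^ 2) - .C (a4 * q) * .X) - .C τ * .X) * .X
          + .C b3 * (.C q - .C a4 * .X) * ((.C (q ^ 2) - .C (a4 * q) * .X) ^ 2
            - .C (τ ^ 2) * .X ^ 2) * .X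
          + .C k * ((.C q - .C a4 * .X) ^ 2 - .C τ * .X + .C (a4 + a5) * (.C q
            - .C a4 * .X) * .X) * .X ^ 2
          - .C (1 / τ) * (.C q - .C a4 * .X) * .X ^ 3) (fun s hs => by
          simp only [Polynomial.eval_add, Polynomial.eval_sub, Polynomial.eval_mul,
            Polynomial.eval_pow, Polynomial.eval_C, Polynomial.eval_X]
          field_simp
          ring)
      simp only [Polynomial.eval_add, Polynomial.eval_sub, Polynomial.eval_mul,
        Polynomial.eval_pow, Polynomial.eval_C, Polynomial.eval_X] at this
      linear_combination this
  -- The same for poles of order three.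
  obtain ⟨rfl, -, rfl, rfl, rfl, rfl, rfl, -⟩ := eq_zero_of_forall_eight (c0 := c30) (c1 := 0)
    (c2 := c21) (c3 := b1) (c4 := c12) (c5 := b3) (c6 := c03) (c7 := 0) fun q hq => by
      have := ((hreg 0 0 0 q 0 hq).mul (id.pow 2)).eval_zero
        (.C c00 * .X ^ 3
          + .C c01 * (.C (q ^ 2) - .C (a4 * q) * .X) * .X ^ 2
          + .C c02 * (.C (q ^ 2) - .C (a4 * q) * .X) ^ 2 * .X
          + .C c03 * (.C (q ^ 2) - .C (a4 * q) * .X) ^ 3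
          + .C c10 * .X ^ 2
          + .C c11 * (.C (q ^ 2) - .C (a4 * q) * .X) * .X
          + .C c12 * (.C (q ^ 2) - .C (a4 * q) * .X) ^ 2
          + .C c20 * .X
          + .C c21 * (.C (q ^ 2) - .C (a4 * q) * .X)
          + .C c30
          + .C e0 * (.C q + .C a3 * .X) * .X
          + .C h * ((.C q + .C a3 * .X) ^ 2
            + .C (2 * (a0 + a1 + a2)) * (.C q + .C a3 * .X) * .X) * .X
          + .C b0 * (.C q - .C a4 * .X) * ((.C (q ^ 2) - .C (a4 * q) * .X) - .C τ * .X) * .X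
          + .C b1 * (.C q - .C a4 * .X) * ((.C (q ^ 2) - .C (a4 * q) * .X) - .C τ * .X)
          + .C b3 * (.C q - .C a4 * .X) * ((.C (q ^ 2) - .C (a4 * q) * .X) ^ 2
            - .C (τ ^ 2) * .X ^ 2)
          + .C k * ((.C q - .C a4 * .X) ^ 2 - .C τ * .X + .C (a4 + a5) * (.C q
            - .C a4 * .X) * .X) * .X
          - .C (1 / τ) * (.C q - .C a4 * .X) * .X ^ 2) (fun s hs => by
          simp only [Polynomial.eval_add, Polynomial.eval_sub, Polynomial.eval_mul,
            Polynomial.eval_pow, Polynomial.eval_C, Polynomial.eval_X]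
          field_simp
          ring)
      simp only [Polynomial.eval_add, Polynomial.eval_sub, Polynomial.eval_mul,
        Polynomial.eval_pow, Polynomial.eval_C, Polynomial.eval_X] at this
      linear_combination this
  -- Poles of order one and two, with `y` kept free in order to separate `c01` from `c11 + 2 * h`.
  have h2 : ∀ y q, q ≠ 0 →
      c10 + c01 * q ^ 2 + c11 * (y * q ^ 2 - a4 * q) + c20 * (2 * y)
        - 2 * a4 * c02 * q ^ 3 + b0 * (-2 * a4 * q ^ 2 - τ * q) + e0 * (2 * y * q + a3)
        + h * (2 * a3 * q + 2 * y * q ^ 2 + 2 * (a0 + a1 + a2) * q)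
        + k * ((a5 - a4) * q - τ) - q / τ = 0 ∧
      c20 + c11 * q ^ 2 + c02 * q ^ 4 + b0 * q ^ 3 + e0 * q + h * q ^ 2 + k * q ^ 2 = 0 ∧
      (0 : F) = 0 ∧ (0 : F) = 0 := fun y q hq =>
    polar_part_four (g := fun s => c00 + c10 * y - c01 * a4 * q + c20 * y ^ 2 - c11 * a4 * q * y
        + c02 * a4 ^ 2 * q ^ 2 + b0 * (a4 * (a4 * q + τ)) + e0 * (-a1 * y + 2 * a3 * y)
        + h * (a3 ^ 2 + 2 * y * (q * (2 * a3 + a2) + a3 * s * (a3 + a2))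
          + 2 * (a0 + a1 + a2) * a3) - k * a4 * a5 + a4 / τ)
      (hreg 0 y 0 q 0 hq) (by fun_prop) fun s hs => by field_simp; ring
  obtain ⟨rfl, rfl, d2, rfl, rfl, -⟩ := eq_zero_of_forall_eight (c0 := c20) (c1 := e0)
    (c2 := c11 + h + k) (c3 := b0) (c4 := c02) (c5 := 0) (c6 := 0) (c7 := 0) fun q hq => by
      linear_combination (h2 0 q hq).2.1
  have h1 : ∀ y, _ := fun y => eq_zero_of_forall_four (c0 := c10 - k * τ)
    (c1 := -a4 * c11 + h * (2 * a3 + 2 * (a0 + a1 + a2)) + k * (a5 - a4) - 1 / τ)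
    (c2 := c01 + y * (c11 + 2 * h)) (c3 := 0) fun q hq => by linear_combination (h2 y q hq).1
  obtain ⟨d0, d1, d3, -⟩ := h1 0
  have d4 := (h1 1).2.2.1
  -- Since `c11 = -2 * h` and `k = h`, equation `d1` reads `h * (2 * a0 + 2 * a1 + 2 * a2 + 2 * a3 +
  -- a4 + a5) = 1 / τ`.
  have hh : h = 1 / τ := by
    linear_combination -h * ha + d1 + a4 * (d4 - d3) - (a5 - a4) * (d2 - d4 + d3)
  have hc : c11 = -2 * h := by linear_combination d4 - d3
  have hk : k = h := by linear_combination d2 - hc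
  refine ⟨⟨⟨rfl, rfl, rfl⟩, ⟨by linear_combination d3, rfl, rfl⟩, ⟨rfl, rfl, rfl⟩, rfl, rfl, rfl⟩,
    ⟨rfl, rfl, rfl⟩, ⟨rfl, rfl, rfl⟩, hh, hk.trans hh, ?_, ?_⟩
  · rw [hk, hh] at d0
    field_simp at d0
    linear_combination d0
  · rw [hc, hh]
    ring

end IsRegular

/-! ### Determination of the Hamiltonian and its vector field -/

open RatFunc

/-- The Hamiltonian is determined by its regularity in the charts, as a function. -/
theorem eval_eq_of_isPolynomialIn {α : Fin 6 → ℂ}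
    (hα : 2 * α 0 + 2 * α 1 + 2 * α 2 + 2 * α 3 + α 4 + α 5 = 1)
    {H : Poly} (hdeg : H.totalDegree = 4)
    (h0 : IsPolynomialIn (r0 α coord) (algebraMap Poly RatField H))
    (h1 : IsPolynomialIn (r1 α coord) (algebraMap Poly RatField H))
    (h2 : IsPolynomialIn (r2 α coord) (algebraMap Poly RatField H))
    (h4 : IsPolynomialIn (r4 α coord) (algebraMap Poly RatField H))
    (h5 : IsPolynomialIn (r5 α coord) (algebraMap Poly RatField (H + MvPolynomial.X 4)))
    (h3 : IsPolynomialIn (r3 α (r4 α coord)) (algebraMap Poly RatField H)) :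
    ∃ c : Coef, ∀ x y z w q p, MvPolynomial.eval ![x, y, z, w, q, p] H =
      MvPolynomial.eval ![x, y, z, w, q, p] (hamiltonianB5 α) + c := by
  have ht : t ≠ 0 := RatFunc.X_ne_zero
  have ha : 2 * C (α 0) + 2 * C (α 1) + 2 * C (α 2) + 2 * C (α 3) + C (α 4) + C (α 5) =
      (1 : Coef) := by
    have h := congrArg (C : ℂ →+* RatFunc ℂ) hα
    simpa only [map_add, map_mul, map_ofNat, map_one] using h
  obtain ⟨c, hc, hH⟩ := exists_coeff hdeg
  have R0 := slice_relations_r0 h0 hc hH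
  have R2 := slice_relations_r2 h2 hc hH
  have hnf : ∀ o ∈ expBox, ∀ x y z w, _ := fun o ho =>
    sum_sum_eq_normalForm (e := fun m n => c m n o) (fun m n h => hc m n o (by omega))
      (fun n => R0 n o) (fun m => R2 m o) (isRegular_slice_r1 h1 hH ho)
  have hform : ∀ x y z w q p, MvPolynomial.eval ![x, y, z, w, q, p] H =
        c (0, 0) (0, 0) (0, 0) + c (0, 0) (0, 1) (0, 0) * (y + w) + c (0, 0) (0, 2) (0, 0) * (y
          + w) ^ 2 + c (0, 0) (0, 3) (0, 0) * (y + w) ^ 3 + c (0, 0) (0, 4) (0, 0) * (y + w) ^ 4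
          + (c (1, 2) (0, 0) (0, 0) + c (1, 3) (0, 0) (0, 0) * (y + w)) * (x * y ^ 2
            - C (α 1) * y + z * w * (2 * y + w))
          + c (2, 2) (0, 0) (0, 0) * (x ^ 2 * y ^ 2 + 2 * C (α 0) * x * y + x + z ^ 2 * w ^ 2
            + 2 * y * z * (z * w + C (α 2)) + 2 * (C (α 0) + C (α 1) + C (α 2)) * z * w)
          + (c (0, 0) (0, 0) (0, 1) + c (0, 0) (0, 1) (0, 1) * (y + w)
            + c (0, 0) (0, 2) (0, 1) * (y + w) ^ 2 + c (0, 0) (0, 3) (0, 1) * (y + w) ^ 3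
            + c (1, 2) (0, 0) (0, 1) * (x * y ^ 2 - C (α 1) * y + z * w * (2 * y + w))) * p
          + (c (0, 0) (0, 0) (0, 2) + c (0, 0) (0, 1) (0, 2) * (y + w)
            + c (0, 0) (0, 2) (0, 2) * (y + w) ^ 2) * p ^ 2
          + (c (0, 0) (0, 0) (0, 3) + c (0, 0) (0, 1) (0, 3) * (y + w)) * p ^ 3
            + c (0, 0) (0, 0) (0, 4) * p ^ 4
          + (c (0, 0) (0, 0) (1, 2) + c (0, 0) (0, 1) (1, 2) * (y + w)) * (q * p ^ 2 - t * q * p)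
          + c (0, 0) (0, 0) (1, 3) * (q * p ^ 3 - t ^ 2 * q * p)
          + c (0, 0) (0, 0) (2, 2) * (q ^ 2 * p ^ 2 - t * q ^ 2 * p - C (α 4) * t * q
            + (C (α 4) + C (α 5)) * q * p)
          - 1 / t * q * p := by
    intro x y z w q p
    let f : ℕ × ℕ → Coef := fun o =>
      ∑ n ∈ expBox, (∑ m ∈ expBox, c m n o * (x ^ m.1 * y ^ m.2)) * (z ^ n.1 * w ^ n.2)
    have hf : ∀ o : ℕ × ℕ, 4 < o.1 + o.2 → f o = 0 := fun o ho =>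
      Finset.sum_eq_zero fun n _ => by
        rw [Finset.sum_eq_zero fun m _ => by rw [hc m n o (by omega), zero_mul], zero_mul]
    -- In the pair `(q, p)` the chart `r₄` has the same shape as `r₂` in `(z, w)`.
    have R4 := IsRegular.r2_relations hf (β := C (α 4)) fun p =>
      (isRegular_r4 h4 x y z w p).congr fun s _ => hH _ _ _ _ _ _
    obtain ⟨R5, R5'⟩ := IsRegular.r5_relations hf (β := C (α 5)) ht R4
      ((isRegular_r5 h5 x y z w 0).congr fun s _ => by
        rw [map_add, hH, MvPolynomial.eval_X]
        rfl)
    rw [hH]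
    refine (sum_expBox hf q p).trans ?_
    obtain ⟨e1, e2, e3, e4, e5⟩ := R4
    rw [e1, e2, e3, e4, e5, R5', R5]
    simp only [f]
    simp only [hnf (0, 0) (by decide), hnf (0, 1) (by decide), hnf (0, 2) (by decide),
      hnf (0, 3) (by decide), hnf (0, 4) (by decide), hnf (1, 2) (by decide),
      hnf (1, 3) (by decide), hnf (2, 2) (by decide)]
    simp (disch := norm_num) only [hc]
    ring
  have hreg : ∀ x y z q p : Coef, q ≠ 0 → IsRegular fun s => _ := fun x y z q p hq =>
    (isRegular_r3_r4 h3 x y z q p hq).congr fun s _ => hform _ _ _ _ _ _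
  obtain ⟨⟨⟨e1, e2, e3⟩, ⟨e4, e5, e6⟩, ⟨e7, e8, e9⟩, e10, e11, e12⟩, ⟨e13, e14, e15⟩,
    ⟨e16, e17, e18⟩, e19, e20, e21, e22⟩ := IsRegular.r3_relations ha ht hreg
  refine ⟨c (0, 0) (0, 0) (0, 0), fun x y z w q p => ?_⟩
  rw [hform, e1, e2, e3, e4, e5, e6, e7, e8, e9, e10, e11, e12, e13, e14, e15, e16, e17, e18, e19,
    e20, e21, e22]
  simp [hamiltonianB5, pc]
  field_simp
  ring

/-- The Hamiltonian vector field of the Hamiltonian of type `B₅⁽¹⁾`. -/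
theorem hamiltonianField_hamiltonianB5 {α : Fin 6 → ℂ}
    (hα : 2 * α 0 + 2 * α 1 + 2 * α 2 + 2 * α 3 + α 4 + α 5 = 1) :
    hamiltonianField (hamiltonianB5 α) = fieldB5 α := by
  -- Eliminating `α 5` turns `α 4 + α 5 - 1` into `-2 * (α 0 + α 1 + α 2 + α 3)`, the form in which
  -- it enters the field.
  have h5 : pc (α 5) =
      1 - 2 * pc (α 0) - 2 * pc (α 1) - 2 * pc (α 2) - 2 * pc (α 3) - pc (α 4) := by
    rw [show α 5 = 1 - 2 * α 0 - 2 * α 1 - 2 * α 2 - 2 * α 3 - α 4 by linear_combination hα]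
    simp only [pc, map_sub, map_mul, map_ofNat, map_one]
  have hadd : ∀ a b, pc (a + b) = pc a + pc b := fun a b => by simp only [pc, map_add]
  have hsub : pc (α 4 + α 5 - 1) = pc (α 4) + pc (α 5) - 1 := by
    simp only [pc, map_sub, map_add, map_one]
  have hd : ∀ i a, MvPolynomial.pderiv i (pc a) = 0 := fun i a => MvPolynomial.pderiv_C
  have h2 : ∀ i, MvPolynomial.pderiv i (2 : Poly) = 0 := fun i => by
    rw [← map_ofNat MvPolynomial.C]
    exact MvPolynomial.pderiv_C
  have hX : ∀ i j : Fin 6, MvPolynomial.pderiv i (MvPolynomial.X j : Poly) = if i = j then 1 else 0 := by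
    intro i j
    rw [MvPolynomial.pderiv_X, Pi.single_apply]
    simp only [eq_comm]
  simp only [hamiltonianField, hamiltonianB5, fieldB5, hsub, h5, hadd]
  simp [hd, h2, hX, Derivation.leibniz_pow]
  refine ⟨Or.inl ?_, ?_, Or.inl ?_, ?_, Or.inl ?_, ?_⟩ <;> ring

end B5

theorem theorem3p2 (α : Fin 6 → ℂ)
    (hα : 2 * α 0 + 2 * α 1 + 2 * α 2 + 2 * α 3 + α 4 + α 5 = 1)
    (H : B5.Poly)
    (hdeg : H.totalDegree = 4)
    (h0 : B5.IsPolynomialIn (B5.r0 α B5.coord) (algebraMap B5.Poly B5.RatField H))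
    (h1 : B5.IsPolynomialIn (B5.r1 α B5.coord) (algebraMap B5.Poly B5.RatField H))
    (h2 : B5.IsPolynomialIn (B5.r2 α B5.coord) (algebraMap B5.Poly B5.RatField H))
    (h4 : B5.IsPolynomialIn (B5.r4 α B5.coord) (algebraMap B5.Poly B5.RatField H))
    (h5 : B5.IsPolynomialIn (B5.r5 α B5.coord)
      (algebraMap B5.Poly B5.RatField (H + MvPolynomial.X 4)))
    (h3 : B5.IsPolynomialIn (B5.r3 α (B5.r4 α B5.coord)) (algebraMap B5.Poly B5.RatField H)) :
    B5.hamiltonianField H = B5.fieldB5 α ∧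
      ∃ c : B5.Coef, H = B5.hamiltonianB5 α + MvPolynomial.C c := by
  obtain ⟨c, hc⟩ := B5.eval_eq_of_isPolynomialIn hα hdeg h0 h1 h2 h4 h5 h3
  have hH : H = B5.hamiltonianB5 α + MvPolynomial.C c := by
    -- Over an infinite field a polynomial is determined by its values.
    refine MvPolynomial.funext fun v => ?_
    have hv : v = ![v 0, v 1, v 2, v 3, v 4, v 5] := by
      ext i
      fin_cases i <;> rfl
    rw [hv, hc, map_add, MvPolynomial.eval_C]
  refine ⟨?_, c, hH⟩
  rw [← B5.hamiltonianField_hamiltonianB5 hα, hH]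
  simp [B5.hamiltonianField]
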